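/- Let $1\le d<D$ be integers and $\kappa>0$. The reach $\Delta(M)$ of a set $M\subset\mathbb R^D$ is the largest $r$ such that every point of $M\oplus r=\bigcup_{x\in M}B_D(x,r)$ has a unique nearest point in $M$. For a compact set $\mathcal K\subset\mathbb R^D$ with nonempty interior, let $\mathcal M$ be the class of all connected $d$-dimensional smooth embedded submanifolds (without boundary) $M$ of $\mathbb R^D$ with $M\subset\mathcal K$ and $\Delta(M)\ge\kappa$. For $M\in\mathcal M$ and fixed constants $0<b\le B<\infty$, let $\mathcal G(M)$ be the set of probability distributions $G$ on $M$ that have a density $g$ with respect to the uniform distribution on $M$ satisfying $b\le g\le B$ on $M$. In the clutter noise model with fixed $0<\pi\le 1$ one observes independent $Y_1,\dots,Y_n\sim Q=(1-\pi)U+\pi G$, where $U$ is uniform on $\mathcal K$, $G\in\mathcal G(M_0)$ and $M_0\in\mathcal M$; let $\mathcal Q$ be the set of all such $Q$ (each together with its manifold $M_0$). Let $\varepsilon_n=(K\log n/n)^{2/d}$. For $M\in\mathcal M$ and $y\in M$ let the slab $S_M(y)$ be a hyper-rectangle centered at $y$ with side $b_1\sqrt{\varepsilon_n}$ in $d$ orthonormal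 directions spanning the tangent space $T_yM$ and side $b_2\varepsilon_n$ in $D-d$ orthonormal directions normal to it (any choice of the orthonormal directions is allowed). Let $\hat Q_n$ be the empirical measure of the sample, $s(M)=\inf_{y\in M}\hat Q_n[S_M(y)]$, and let $\hat M_n$ be any maximizer of $s$ over $\mathcal M$ (slabs exist, and if $\mathcal M\neq\varnothing$ a maximizer exists for every sample of size $n\ge 1$; ties are broken arbitrarily). Let $H$ be the Hausdorff distance. There is $b_0>0$, depending only on $d,D,\kappa$, such that for all $b_1,b_2\in(0,b_0]$, all $\mathcal K,b,B,\pi$ as above and every $\xi>1$ there is $K_0>0$ such that for every $K\ge K_0$ the following hold. For all sufficiently large $n$ (depending on all these constants, including $K$, but not on $Q$ or on the choices of the slabs and of the maximizer), $$\sup_{Q\in\mathcal Q}Q^n\bigl(H(M_0,\hat M_n)>\varepsilon_n\bigr)<n^{-\xi},$$ and there is a constant $C$ (depending on the same constants) such that for all $n\ge 2$ $$\sup_{Q\in\mathcal Q}\mathbb E_{Q^n}\bigl[H(M_0,\hat M_n)\bigr]\le C\varepsilon_n .$$ No measurability of $\hat M_n$ is assumed: probabilities and expectations are outer ones, which agree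 with the usual ones whenever $H(M_0,\hat M_n)$ is measurable. -/

import Mathlib

open MeasureTheory
open scoped ENNReal NNReal ContDiff

noncomputable section

/-- The Euclidean space `ℝ^D`, with the Euclidean norm. -/
abbrev Euc (D : ℕ) : Type := EuclideanSpace ℝ (Fin D)

/-- `M` is a `d`-dimensional smooth embedded submanifold (without boundary) of `ℝ^D`: around every
point of `M` there is a smooth slice chart of `ℝ^D` that straightens `M` to `ℝ^d × {0}`. -/
def IsSmoothSubmanifold {D : ℕ} (d : ℕ) (M : Set (Euc D)) : Prop :=
  ∀ p ∈ M, ∃ Φ : OpenPartialHomeomorph (Euc D) (Euc D),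
    p ∈ Φ.source ∧
    ContDiffOn ℝ ∞ Φ Φ.source ∧
    ContDiffOn ℝ ∞ Φ.symm Φ.target ∧
    ∀ x ∈ Φ.source, x ∈ M ↔ ∀ i : Fin D, d ≤ (i : ℕ) → Φ x i = 0

/-- The open tube `M ⊕ r`, the union of the open balls of radius `r` centred on `M`. -/
def tube {D : ℕ} (M : Set (Euc D)) (r : ℝ) : Set (Euc D) :=
  ⋃ x ∈ M, Metric.ball x r

/-- Every point of `M ⊕ r` has a unique projection (nearest point) onto `M`. -/
def HasUniqueProjections {D : ℕ} (M : Set (Euc D)) (r : ℝ) : Prop :=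
  ∀ x ∈ tube M r, ∃! p, p ∈ M ∧ dist x p = Metric.infDist x M

/-- The reach (condition number) `Δ(M)`: the largest `r` such that every point of `M ⊕ r` has a
unique projection onto `M` (`∞` if there is no largest one). -/
def reach {D : ℕ} (M : Set (Euc D)) : ℝ≥0∞ :=
  sSup {r : ℝ≥0∞ | ∃ s : ℝ≥0, r = s ∧ HasUniqueProjections M s}

/-- The class of the connected smooth `d`-dimensional submanifolds of `ℝ^D` that are contained in
`𝒦` and have reach at least `κ`. For compact `𝒦` and `κ > 0` its members are compact, since a
set of positive reach is closed. -/
def manifoldClass {D : ℕ} (d : ℕ) (κ : ℝ) (𝒦 : Set (Euc D)) : Set (Set (Euc D)) :=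
  {M | IsConnected M ∧ IsSmoothSubmanifold d M ∧ ENNReal.ofReal κ ≤ reach M ∧ M ⊆ 𝒦}

/-- The uniform distribution on a `d`-dimensional submanifold: normalized `d`-dimensional
Hausdorff measure (equivalently, normalized Riemannian volume). -/
def uniformOnManifold {D : ℕ} (d : ℕ) (M : Set (Euc D)) : Measure (Euc D) :=
  ProbabilityTheory.cond (Measure.hausdorffMeasure (d : ℝ)) M

/-- The probability distributions on `M` that have a density with respect to the uniform
distribution on `M` taking values in `[b, B]` on `M`. -/
def densityClass {D : ℕ} (d : ℕ) (b B : ℝ) (M : Set (Euc D)) : Set (Measure (Euc D)) :=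
  {G | IsProbabilityMeasure G ∧ ∃ g : Euc D → ℝ, Measurable g ∧
    (∀ y ∈ M, b ≤ g y ∧ g y ≤ B) ∧
    G = (uniformOnManifold d M).withDensity (fun y => ENNReal.ofReal (g y))}

/-- The clutter noise model: the pairs `(M, Q)` of a manifold `M` in the class and a distribution
`Q = (1 - π) U + π G`, where `U` is uniform on `𝒦` and `G` belongs to the class of `M`. -/
def clutterModel {D : ℕ} (d : ℕ) (κ : ℝ) (𝒦 : Set (Euc D)) (b B π : ℝ) :
    Set (Set (Euc D) × Measure (Euc D)) :=
  {p | p.1 ∈ manifoldClass d κ 𝒦 ∧ ∃ G ∈ densityClass d b B p.1,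
    p.2 = ENNReal.ofReal (1 - π) • ProbabilityTheory.cond volume 𝒦 + ENNReal.ofReal π • G}

/-- The joint distribution `Q^n` of `n` independent observations from `Q`. -/
def sampleLaw {D : ℕ} (Q : Measure (Euc D)) (n : ℕ) : Measure (Fin n → Euc D) :=
  Measure.pi (fun _ => Q)

/-- The tangent space `T_y M`, as a linear subspace of `ℝ^D`. -/
def tangentSpaceAt {D : ℕ} (M : Set (Euc D)) (y : Euc D) : Submodule ℝ (Euc D) :=
  Submodule.span ℝ (tangentConeAt ℝ M y)

/-- `S` is a slab of `M` at `y`: the closed hyper-rectangle centred at `y` that has side `ℓ₁` in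
`d` orthonormal directions spanning `T_y M`, and side `ℓ₂` in `D - d` orthonormal directions
normal to `T_y M`. -/
def IsSlab {D : ℕ} (d : ℕ) (ℓ₁ ℓ₂ : ℝ) (M : Set (Euc D)) (y : Euc D) (S : Set (Euc D)) : Prop :=
  ∃ e : OrthonormalBasis (Fin D) ℝ (Euc D),
    Submodule.span ℝ (e '' {i : Fin D | (i : ℕ) < d}) = tangentSpaceAt M y ∧
    S = {x | ∀ i : Fin D, |inner ℝ (e i) (x - y)| ≤ (if (i : ℕ) < d then ℓ₁ else ℓ₂) / 2}

/-- `S` selects a slab `S M y` for each manifold `M` in the class and each point `y` of `M`. -/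
def IsSlabChoice {D : ℕ} (d : ℕ) (κ : ℝ) (𝒦 : Set (Euc D)) (ℓ₁ ℓ₂ : ℝ)
    (S : Set (Euc D) → Euc D → Set (Euc D)) : Prop :=
  ∀ M ∈ manifoldClass d κ 𝒦, ∀ y ∈ M, IsSlab d ℓ₁ ℓ₂ M y (S M y)

/-- The empirical measure `Q̂_n(A)` of the sample `Y`: the fraction of the observations in `A`. -/
def empiricalMass {D n : ℕ} (Y : Fin n → Euc D) (A : Set (Euc D)) : ℝ :=
  (Nat.card {i : Fin n // Y i ∈ A} : ℝ) / n

/-- The smallest empirical mass `s(M) = inf_{y ∈ M} Q̂_n(S_M(y))` of the slabs of `M`. -/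
def minSlabMass {D n : ℕ} (S : Set (Euc D) → Euc D → Set (Euc D)) (Y : Fin n → Euc D)
    (M : Set (Euc D)) : ℝ :=
  ⨅ y : M, empiricalMass Y (S M y)

/-- `Mhat` is a version of the estimator `argmax_M s(M)`: for every sample it takes as its value
some maximizer of `s` over the class of manifolds (ties are broken arbitrarily). -/
def IsArgmaxEstimator {D n : ℕ} (d : ℕ) (κ : ℝ) (𝒦 : Set (Euc D))
    (S : Set (Euc D) → Euc D → Set (Euc D)) (Mhat : (Fin n → Euc D) → Set (Euc D)) : Prop :=
  ∀ Y : Fin n → Euc D, Mhat Y ∈ manifoldClass d κ 𝒦 ∧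
    IsMaxOn (minSlabMass S Y) (manifoldClass d κ 𝒦) (Mhat Y)

/-- The outer (upper) expectation of `f ≥ 0`: the infimum of the expectations of the measurable
functions that dominate `f`. It is the ordinary expectation if `f` is measurable. -/
def outerExpectation {Ω : Type*} [MeasurableSpace Ω] (P : Measure Ω) (f : Ω → ℝ≥0∞) : ℝ≥0∞ :=
  ⨅ (g : Ω → ℝ≥0∞) (_ : Measurable g) (_ : ∀ x, f x ≤ g x), ∫⁻ x, g x ∂P

/-- The resolution `ε_n = (K log n / n)^{2/d}`. -/
def resolution (d : ℕ) (K : ℝ) (n : ℕ) : ℝ :=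
  (K * Real.log n / n) ^ (2 / (d : ℝ))

end

/-! Put `ε = ε_n`. The exponent `2/d` makes `√ε ^ d = K log n / n`, so a ball of radius of order
`√ε` centred on `M₀` is expected to hold at least a constant multiple of `K log n` observations
lying on `M₀`. All observations off `M₀` are uniform clutter, and such a ball holds of order `n √ε ^
D` of them on average; since `d < D`, this is smaller by a factor of at most order `√ε`. Hence some
threshold `τ` proportional to `K log n` separates the two counts. Chernoff bounds on polynomially
many net points make this uniform over all balls, with failure probability a power of `n` that
improves with `K` (`sampleLaw_uniform_deviation`).

On this event the estimator is close for deterministic reasons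
(`IsArgmaxEstimator.hausdorffDist_le`). Positive reach keeps `M₀` within `r² / (2κ)` of its tangent
space at distance `r`, so every slab of `M₀` contains a piece of `M₀` of radius of order `√ε`, and
`s(M₀) ≥ τ / n`. If `M` is farther than `ε` from `M₀`, then some slab of `M` misses `M₀` entirely
(`exists_disjoint_of_lt_hausdorffDist`). It contains only clutter, so `s(M) < τ / n` and `M` is not
a maximizer.

The disjoint slab comes from a pair `x ∈ M₀`, `y ∈ M` realizing the largest distance from one set to
the other. The segment between them is normal to both manifolds: at one end by minimality, at the
other by maximality. The slab at `y` is thin along this segment, while Federer's inequality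
(`inner_le_of_mem_orthogonal`) keeps `M₀` close to its tangent plane at `x`, a distance `> ε` away.
When `M` lies near `M₀` but misses a distant part of it, connectedness of `M₀` and comparison of
tangent spaces give a contradiction (`infDist_ne_of_close`).

Smoothness is used only to provide tangent spaces of dimension `d`; the quantitative geometry comes
from the unique projections. The tangent spaces at nearby points are compared by a
minimal-counterexample argument (`inner_le_half_of_mem_tangentSpaceAt`), which also yields the
volume bounds. -/

/-! ### Unique nearest points and balls touching the set. -/

section NearestPoints

open Metric

variable {E : Type*} [NormedAddCommGroup E] [InnerProductSpace ℝ E] {M : Set E} {κ : ℝ}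

/-- Every point at distance less than `κ` from `M` has a unique nearest point in `M`. -/
def UniqueNearestWithin {E : Type*} [PseudoMetricSpace E] (M : Set E) (κ : ℝ) : Prop :=
  ∀ x, infDist x M < κ → ∃! p, p ∈ M ∧ dist x p = infDist x M

/-- The nearest point depends continuously on the point, wherever it is unique. -/
lemma exists_ball_nearest_close {E : Type*} [PseudoMetricSpace E] {M : Set E}
    (hM : IsCompact M) {x p : E} (huniq : ∀ q ∈ M, dist x q = infDist x M → q = p)
    {η : ℝ} (hη : 0 < η) :
    ∃ ρ > 0, ∀ y, dist y x < ρ → ∀ q ∈ M, dist y q = infDist y M → dist q p < η := by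
  set L : Set E := M ∩ {q | η ≤ dist q p} with hL
  have hLc : IsCompact L :=
    hM.inter_right (isClosed_le continuous_const (continuous_id.dist continuous_const))
  rcases L.eq_empty_or_nonempty with hne | hne
  · refine ⟨1, one_pos, fun y _ q hq _ => ?_⟩
    by_contra h
    have : q ∈ L := ⟨hq, not_lt.1 h⟩
    simp [hne] at this
  · obtain ⟨q₀, hq₀, hd⟩ := hLc.exists_infDist_eq_dist hne x
    have hlt : infDist x M < infDist x L := by
      rw [hd]
      refine lt_of_le_of_ne (infDist_le_dist_of_mem hq₀.1) fun h => ?_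
      have h0 := huniq q₀ hq₀.1 h.symm
      have := hq₀.2
      simp only [Set.mem_ofPred_eq, h0, dist_self] at this
      linarith
    refine ⟨(infDist x L - infDist x M) / 2, by linarith, fun y hy q hq hyq => ?_⟩
    by_contra h
    have hqL : q ∈ L := ⟨hq, not_lt.1 h⟩
    have h1 : infDist x L ≤ dist x q := infDist_le_dist_of_mem hqL
    have h2 : dist x q ≤ dist x y + dist y q := dist_triangle _ _ _
    have h3 : infDist y M ≤ infDist x M + dist y x := infDist_le_infDist_add_dist
    rw [dist_comm x y] at h2
    linarith

/-- First-order lower bound for the squared distance at a point with unique nearest point. -/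
lemma infDist_sq_growth (hM : IsCompact M) {x p : E} (hp : p ∈ M)
    (huniq : ∀ q ∈ M, dist x q = infDist x M → q = p)
    {η : ℝ} (hη : 0 < η) :
    ∃ ρ > 0, ∀ y, dist y x < ρ →
      infDist x M ^ 2 + 2 * inner ℝ (y - x) (x - p) - η * ‖y - x‖ ≤ infDist y M ^ 2 := by
  obtain ⟨ρ, hρ, H⟩ := exists_ball_nearest_close hM huniq (half_pos hη)
  refine ⟨ρ, hρ, fun y hy => ?_⟩
  obtain ⟨q, hq, hyq⟩ := hM.exists_infDist_eq_dist ⟨p, hp⟩ y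
  have h1 := H y hy q hq hyq.symm
  have h2 : infDist x M ≤ dist x q := infDist_le_dist_of_mem hq
  have h0 : 0 ≤ infDist x M := infDist_nonneg
  rw [dist_eq_norm] at h1 h2
  have h3 : infDist y M ^ 2 = ‖y - x‖ ^ 2 + 2 * inner ℝ (y - x) (x - q) + ‖x - q‖ ^ 2 := by
    rw [hyq, dist_eq_norm, ← norm_add_sq_real]; congr 2; abel
  have h4 : inner ℝ (y - x) (x - q) = inner ℝ (y - x) (x - p) - inner ℝ (y - x) (q - p) := by
    rw [← inner_sub_right]; congr 1; abel
  have h5 : inner ℝ (y - x) (q - p) ≤ ‖y - x‖ * (η / 2) :=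
    (real_inner_le_norm _ _).trans (by gcongr)
  have h6 : infDist x M ^ 2 ≤ ‖x - q‖ ^ 2 := by gcongr
  nlinarith [sq_nonneg ‖y - x‖]

/-- Within the tube of unique projections, a point can be moved away from its nearest point `p`
without changing its nearest point. -/
lemma infDist_extend [ProperSpace E] (hM : IsCompact M) (hU : UniqueNearestWithin M κ) {x p : E}
    (hp : p ∈ M) (hxp : dist x p = infDist x M) {h : ℝ} (hh : 0 < h) (hhδ : h ≤ infDist x M)
    (hκ : infDist x M + h < κ) :
    infDist (x + (h / infDist x M) • (x - p)) M = infDist x M + h := by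
  set δ := infDist x M with hδ
  have hδ0 : 0 < δ := hh.trans_le hhδ
  -- Maximize the distance to `M` over the ball of radius `h`; the maximizer turns out to lie
  -- straight beyond `x` as seen from `p`.
  obtain ⟨x', hx', hmax⟩ := (isCompact_closedBall x h).exists_isMaxOn
    ⟨x, mem_closedBall_self hh.le⟩ (continuous_infDist_pt M).continuousOn
  set δ' := infDist x' M with hδ'
  have hle : δ ≤ δ' := hmax (mem_closedBall_self hh.le)
  have hδ'0 : 0 < δ' := hδ0.trans_le hle
  have hle' : δ' ≤ δ + h := (infDist_le_infDist_add_dist (y := x)).trans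
    (by have := mem_closedBall.1 hx'; linarith)
  obtain ⟨p', ⟨hp', hxp'⟩, hu'⟩ := hU x' (hle'.trans_lt hκ)
  have hw : ‖x' - p'‖ = δ' := by rw [← dist_eq_norm, hxp']
  set w := δ'⁻¹ • (x' - p') with hwdef
  have hw1 : ‖w‖ = 1 := by
    rw [hwdef, norm_smul, hw, norm_inv, Real.norm_of_nonneg hδ'0.le, inv_mul_cancel₀ hδ'0.ne']
  have hxw : x' - p' = δ' • w := by rw [hwdef, smul_inv_smul₀ hδ'0.ne']
  set e := h⁻¹ • (x' - x) with hedef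
  have he1 : ‖e‖ ≤ 1 := by
    rw [hedef, norm_smul, norm_inv, Real.norm_of_nonneg hh.le, ← dist_eq_norm, inv_mul_le_iff₀ hh]
    simpa using hx'
  have hxe : x' - x = h • e := by rw [hedef, smul_inv_smul₀ hh.ne']
  clear_value w e
  -- The distance grows at `x'` in the direction `w`. If `w ≠ e`, a small move along `w - e` stays
  -- in the ball, because `x' - x` becomes a convex combination of `e` and `w`, and increases the
  -- distance.
  have hwe : w = e := by
    by_contra hne
    have hv : 0 < ‖w - e‖ := norm_pos_iff.2 (sub_ne_zero.2 hne)
    have hvw : 0 < inner ℝ (w - e) w := by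
      have h1 := norm_sub_sq_real w e
      have h2 : inner ℝ (w - e) w = ‖w‖ ^ 2 - inner ℝ w e := by
        rw [inner_sub_left, real_inner_self_eq_norm_sq, real_inner_comm]
      rw [hw1] at h1 h2
      nlinarith [norm_nonneg e]
    obtain ⟨ρ, hρ, H⟩ := infDist_sq_growth hM hp' (fun q hq hq' => hu' q ⟨hq, hq'⟩)
      (η := δ' * inner ℝ (w - e) w / ‖w - e‖) (by positivity)
    set t := min h (ρ / (2 * ‖w - e‖)) with ht
    have ht0 : 0 < t := lt_min hh (by positivity)
    have hth : t ≤ h := min_le_left _ _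
    have htρ : t * ‖w - e‖ < ρ := by
      have : t ≤ ρ / (2 * ‖w - e‖) := min_le_right _ _
      rw [le_div_iff₀ (by positivity)] at this
      nlinarith
    have hn : ‖x' + t • (w - e) - x'‖ = t * ‖w - e‖ := by
      rw [add_sub_cancel_left, norm_smul, Real.norm_of_nonneg ht0.le]
    have h1 := H (x' + t • (w - e)) (by rwa [dist_eq_norm, hn])
    rw [hn, add_sub_cancel_left, hxw, inner_smul_left, inner_smul_right] at h1
    simp only [conj_trivial] at h1
    have h2 : δ' * inner ℝ (w - e) w / ‖w - e‖ * (t * ‖w - e‖) = t * (δ' * inner ℝ (w - e) w) := by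
      field_simp
    have h3 : x' + t • (w - e) ∈ closedBall x h := by
      rw [mem_closedBall, dist_eq_norm]
      have : x' + t • (w - e) - x = (h - t) • e + t • w := by
        rw [add_sub_right_comm, hxe]; module
      rw [this]
      calc ‖(h - t) • e + t • w‖ ≤ (h - t) * ‖e‖ + t * ‖w‖ := by
            refine (norm_add_le _ _).trans (le_of_eq ?_)
            rw [norm_smul, norm_smul, Real.norm_of_nonneg ht0.le,
              Real.norm_of_nonneg (sub_nonneg.2 hth)]
        _ ≤ (h - t) * 1 + t * 1 := by
            rw [hw1]; gcongr
        _ = h := by ring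
    have h4 : infDist (x' + t • (w - e)) M ≤ δ' := hmax h3
    have h5 : infDist (x' + t • (w - e)) M ^ 2 ≤ δ' ^ 2 := by
      gcongr; exact infDist_nonneg
    rw [h2, ← hδ'] at h1
    have : 0 < t * (δ' * inner ℝ (w - e) w) := by positivity
    linarith
  rw [← hwe] at hxe
  -- Now `x` lies on the segment from `p'` to `x'`; this forces `p'` to be a nearest point of `x`.
  have hxp2 : x - p' = (δ' - h) • w := by
    have : x - p' = (x' - p') - (x' - x) := by abel
    rw [this, hxw, hxe]; module
  have hn : dist x p' = δ' - h := by
    rw [dist_eq_norm, hxp2, norm_smul, hw1, mul_one, Real.norm_of_nonneg (by linarith)]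
  have h6 : δ ≤ dist x p' := infDist_le_dist_of_mem hp'
  have h7 : δ' = δ + h := by linarith
  have h8 : p' = p := by
    obtain ⟨q, -, hq⟩ := hU x (by linarith)
    rw [hq p' ⟨hp', by rw [hn]; linarith⟩, hq p ⟨hp, hxp⟩]
  have h9 : x + (h / δ) • (x - p) = x' := by
    rw [← h8, hxp2, smul_smul, h7, add_sub_cancel_right, div_mul_cancel₀ _ hδ0.ne', ← hxe]
    abel
  rw [h9, ← hδ', h7]

/-- If `p` is the nearest point of `x`, then `M` stays outside the ball of radius `κ` that touches
`M` at `p` in the direction of `x`. -/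
lemma inner_le_of_nearest [ProperSpace E] (hM : IsCompact M) (hU : UniqueNearestWithin M κ)
    {x p z : E} (hp : p ∈ M) (hxp : dist x p = infDist x M) (hx0 : 0 < infDist x M)
    (hxκ : infDist x M < κ) (hz : z ∈ M) :
    2 * κ * inner ℝ (z - p) (x - p) ≤ infDist x M * ‖z - p‖ ^ 2 := by
  set δ := infDist x M with hδ
  set u := δ⁻¹ • (x - p) with hu
  have hu1 : ‖u‖ = 1 := by
    rw [hu, norm_smul, ← dist_eq_norm, hxp, norm_inv, Real.norm_of_nonneg hx0.le,
      inv_mul_cancel₀ hx0.ne']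
  have hxu : x - p = δ • u := by rw [hu, smul_inv_smul₀ hx0.ne']
  have key : ∀ t, δ ≤ t → t < κ → infDist (p + t • u) M = t := by
    intro t ht htκ
    -- One extension can at most double the distance, so any `t < κ` is reached by repeated
    -- doubling, cut off at `t`.
    have claim : ∀ n : ℕ, infDist (p + min (2 ^ n * δ) t • u) M = min (2 ^ n * δ) t := by
      intro n
      induction n with
      | zero =>
        rw [pow_zero, one_mul, min_eq_left ht, ← hxu, add_sub_cancel]
      | succ n ih =>
        set s := min (2 ^ n * δ) t with hs
        set s' := min (2 ^ (n + 1) * δ) t with hs'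
        have h2 : 0 < 2 ^ n * δ := by positivity
        have hs0 : 0 < s := lt_min h2 (hx0.trans_le ht)
        have hss : s ≤ s' := min_le_min_right _ (by rw [pow_succ]; linarith)
        have hss2 : s' ≤ 2 * s := by
          rw [hs, hs', pow_succ]
          rcases le_total (2 ^ n * δ) t with h | h
          · rw [min_eq_left h]; exact (min_le_left _ _).trans (by linarith)
          · rw [min_eq_right h]; exact (min_le_right _ _).trans (by linarith)
        have hsκ : s' < κ := (min_le_right _ _).trans_lt htκ
        rcases hss.eq_or_lt with h | h
        · rw [← h]; exact ih
        · have hd : dist (p + s • u) p = infDist (p + s • u) M := by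
            rw [ih, dist_eq_norm, add_sub_cancel_left, norm_smul, hu1, mul_one,
              Real.norm_of_nonneg hs0.le]
          have := infDist_extend hM hU hp hd (h := s' - s) (by linarith) (by rw [ih]; linarith)
            (by rw [ih]; linarith)
          have h3 : ((s' - s) / s) • s • u = (s' - s) • u := by
            rw [smul_smul, div_mul_cancel₀ _ hs0.ne']
          rw [ih, add_sub_cancel_left, h3, add_assoc, ← add_smul, add_sub_cancel] at this
          exact this
    obtain ⟨n, hn⟩ := pow_unbounded_of_one_lt (t / δ) (one_lt_two)
    rw [div_lt_iff₀ hx0] at hn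
    have := claim n
    rwa [min_eq_right hn.le] at this
  have key2 : ∀ t, δ ≤ t → t < κ → 2 * t * inner ℝ (z - p) u ≤ ‖z - p‖ ^ 2 := by
    intro t ht htκ
    have h1 : t ≤ ‖t • u - (z - p)‖ := by
      calc t = infDist (p + t • u) M := (key t ht htκ).symm
        _ ≤ dist (p + t • u) z := infDist_le_dist_of_mem hz
        _ = _ := by rw [dist_eq_norm]; congr 1; abel
    have h2 : t ^ 2 ≤ ‖t • u - (z - p)‖ ^ 2 := by
      have : 0 ≤ t := hx0.le.trans ht
      gcongr
    rw [norm_sub_sq_real, norm_smul, hu1, inner_smul_left, real_inner_comm, mul_one,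
      Real.norm_of_nonneg (hx0.le.trans ht)] at h2
    simp only [conj_trivial] at h2
    linarith
  rw [hxu, inner_smul_right]
  suffices h : 2 * κ * inner ℝ (z - p) u ≤ ‖z - p‖ ^ 2 by nlinarith
  have hlim : Filter.Tendsto (fun t : ℝ => 2 * t * inner ℝ (z - p) u) (nhdsWithin κ (Set.Iio κ))
      (nhds (2 * κ * inner ℝ (z - p) u)) := by
    apply Filter.Tendsto.mono_left _ nhdsWithin_le_nhds
    exact Continuous.tendsto (by fun_prop) κ
  refine le_of_tendsto hlim ?_
  filter_upwards [Ioo_mem_nhdsLT hxκ] with t ht using key2 t ht.1.le ht.2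

end NearestPoints

/-! ### Tangent spaces of smooth submanifolds. -/

section TangentSpaces

open Filter Asymptotics
open scoped Topology

/-- `T` is the tangent space of `M` at `p` in the differentiable sense: its elements are
velocities of curves in `M`, and `M` does not leave `p + T` to first order. -/
structure IsTangentSpaceAt {E : Type*} [NormedAddCommGroup E] [InnerProductSpace ℝ E]
    (M : Set E) (p : E) (T : Submodule ℝ E) : Prop where
  exists_curve : ∀ v ∈ T, ∃ γ : ℝ → E, γ 0 = p ∧ HasDerivAt γ v 0 ∧ ∀ᶠ t in 𝓝 0, γ t ∈ M
  inner_isLittleO : ∀ u ∈ Tᗮ, (fun z => inner ℝ (z - p) u) =o[𝓝[M] p] fun z => z - p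

/-- A tangent cone vector is a limit of rescaled increments along `M`, whose normal components are
of smaller order, so it is orthogonal to `Tᗮ`. Conversely, rescaling a curve by `t⁻¹` puts its
velocity in the cone. -/
lemma IsTangentSpaceAt.span_tangentConeAt_eq {E : Type*} [NormedAddCommGroup E]
    [InnerProductSpace ℝ E] [FiniteDimensional ℝ E] {M : Set E} {p : E} {T : Submodule ℝ E}
    (h : IsTangentSpaceAt M p T) : Submodule.span ℝ (tangentConeAt ℝ M p) = T := by
  apply le_antisymm
  · rw [Submodule.span_le]
    intro v hv
    obtain ⟨α, l, hl, c, e, he, heM, hce⟩ := exists_fun_of_mem_tangentConeAt hv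
    have : v ∈ Tᗮᗮ := by
      rw [Submodule.mem_orthogonal]
      intro u hu
      have hz : Tendsto (fun n => p + e n) l (𝓝[M] p) := by
        refine tendsto_nhdsWithin_iff.2 ⟨?_, heM⟩
        simpa using he.const_add p
      have h1 := (h.inner_isLittleO u hu).comp_tendsto hz
      simp only [Function.comp_def, add_sub_cancel_left] at h1
      have h2 : (fun n => inner ℝ (c n • e n) u) =o[l] fun n => c n • e n := by
        simp only [inner_smul_left, conj_trivial]
        exact (isBigO_refl c l).smul_isLittleO h1
      have h3 : Tendsto (fun n => inner ℝ (c n • e n) u) l (𝓝 0) := by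
        have h4 := h2.trans_isBigO (hce.isBigO_one ℝ)
        rwa [isLittleO_one_iff] at h4
      have h4 : Tendsto (fun n => inner ℝ (c n • e n) u) l (𝓝 (inner ℝ v u)) :=
        hce.inner tendsto_const_nhds
      rw [real_inner_comm]
      exact tendsto_nhds_unique h4 h3
    rwa [Submodule.orthogonal_orthogonal] at this
  · intro v hv
    apply Submodule.subset_span
    obtain ⟨γ, h0, hd, hM⟩ := h.exists_curve v hv
    refine mem_tangentConeAt_of_seq (𝓝[≠] (0 : ℝ)) (fun t => t⁻¹) (fun t => γ t - p) ?_ ?_ ?_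
    · have := hd.continuousAt.tendsto
      rw [h0] at this
      simpa using (this.sub_const p).mono_left nhdsWithin_le_nhds
    · simpa using hM.filter_mono nhdsWithin_le_nhds
    · have := hasDerivAt_iff_tendsto_slope.1 hd
      refine this.congr fun t => ?_
      simp [slope_def_module, h0]

/-- The coordinate subspace `ℝ^d × {0}` of `ℝ^D`. -/
def coordinateSubspace (d D : ℕ) : Submodule ℝ (Euc D) where
  carrier := {x | ∀ i : Fin D, d ≤ (i : ℕ) → x i = 0}
  add_mem' ha hb i hi := by simp [ha i hi, hb i hi]
  zero_mem' i _ := by simp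
  smul_mem' c x hx i hi := by simp [hx i hi]

lemma finrank_coordinateSubspace {d D : ℕ} (h : d ≤ D) :
    Module.finrank ℝ (coordinateSubspace d D) = d := by
  let f : coordinateSubspace d D ≃ₗ[ℝ] (Fin d → ℝ) :=
    { toFun := fun x i => x.1 (Fin.castLE h i)
      map_add' := fun _ _ => rfl
      map_smul' := fun _ _ => rfl
      invFun := fun y => ⟨WithLp.toLp 2 fun j => if hj : (j : ℕ) < d then y ⟨j, hj⟩ else 0,
        fun i hi => by simp [hi]⟩
      left_inv := fun x => by
        ext j
        by_cases hj : (j : ℕ) < d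
        · simp [hj]
        · simp [hj, x.2 j (not_lt.1 hj)]
      right_inv := fun y => by ext i; simp }
  rw [f.finrank_eq]; simp

variable {d D : ℕ} {M : Set (Euc D)} {p : Euc D}

/-- The tangent space is the image of the coordinate subspace under the derivative `B` of the
inverse chart. Curves are images of straight lines, and the normal part of `z - p` is only the
first-order remainder of the inverse chart. -/
lemma IsSmoothSubmanifold.exists_isTangentSpaceAt (hM : IsSmoothSubmanifold d M) (hd : d ≤ D)
    (hp : p ∈ M) : ∃ T, IsTangentSpaceAt M p T ∧ Module.finrank ℝ T = d := by
  obtain ⟨Φ, hps, hΦ, hΨ, hslice⟩ := hM p hp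
  have hpt : Φ p ∈ Φ.target := Φ.map_source hps
  have hΦd : DifferentiableAt ℝ Φ p :=
    ((hΦ p hps).contDiffAt (Φ.open_source.mem_nhds hps)).differentiableAt (by simp)
  have hΨd : DifferentiableAt ℝ Φ.symm (Φ p) :=
    ((hΨ _ hpt).contDiffAt (Φ.open_target.mem_nhds hpt)).differentiableAt (by simp)
  have hA := hΦd.hasFDerivAt
  have hB := hΨd.hasFDerivAt
  set A := fderiv ℝ Φ p
  set B := fderiv ℝ Φ.symm (Φ p)
  have hAB : A.comp B = ContinuousLinearMap.id ℝ (Euc D) := by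
    have hA' : HasFDerivAt Φ A (Φ.symm (Φ p)) := by rwa [Φ.left_inv hps]
    refine (hA'.comp (Φ p) hB).unique ((hasFDerivAt_id (Φ p)).congr_of_eventuallyEq ?_)
    filter_upwards [Φ.open_target.mem_nhds hpt] with y hy using Φ.right_inv hy
  have hinj : Function.Injective B := fun x y hxy => by
    have := congrArg A hxy
    rwa [← ContinuousLinearMap.comp_apply, ← ContinuousLinearMap.comp_apply, hAB] at this
  have hΦp : Φ p ∈ coordinateSubspace d D := (hslice p hps).1 hp
  refine ⟨(coordinateSubspace d D).map (B : Euc D →ₗ[ℝ] Euc D), ⟨?_, ?_⟩, ?_⟩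
  · rintro _ ⟨w, hw, rfl⟩
    have hl : HasDerivAt (fun t : ℝ => Φ p + t • w) w 0 := by
      simpa using ((hasDerivAt_id (0 : ℝ)).smul_const w).const_add (Φ p)
    refine ⟨fun t => Φ.symm (Φ p + t • w), by simp [Φ.left_inv hps], ?_, ?_⟩
    · have hB' : HasFDerivAt Φ.symm B (Φ p + (0 : ℝ) • w) := by simpa using hB
      exact hB'.comp_hasDerivAt (0 : ℝ) hl
    · have hc : Tendsto (fun t : ℝ => Φ p + t • w) (𝓝 0) (𝓝 (Φ p)) := by
        simpa using hl.continuousAt.tendsto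
      filter_upwards [hc (Φ.open_target.mem_nhds hpt)] with t ht
      have ht' : Φ p + t • w ∈ Φ.target := ht
      rw [hslice _ (Φ.map_target ht'), Φ.right_inv ht']
      exact (coordinateSubspace d D).add_mem hΦp ((coordinateSubspace d D).smul_mem t hw)
  · intro u hu
    have h1 : (fun z => Φ.symm (Φ z) - p - B (Φ z - Φ p)) =o[𝓝 p] fun z => z - p := by
      have h2 := hB.isLittleO.comp_tendsto hΦd.continuousAt.tendsto
      simp only [Function.comp_def, Φ.left_inv hps] at h2
      exact h2.trans_isBigO hA.isBigO_sub
    have h3 : (fun z => inner ℝ (z - p) u) =ᶠ[𝓝[M] p]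
        fun z => inner ℝ (Φ.symm (Φ z) - p - B (Φ z - Φ p)) u := by
      filter_upwards [self_mem_nhdsWithin,
        mem_nhdsWithin_of_mem_nhds (Φ.open_source.mem_nhds hps)] with z hz hzs
      have h4 : inner ℝ (B (Φ z - Φ p)) u = 0 := by
        refine (Submodule.mem_orthogonal _ u).1 hu _ ⟨Φ z - Φ p, ?_, rfl⟩
        exact (coordinateSubspace d D).sub_mem ((hslice z hzs).1 hz) hΦp
      rw [Φ.left_inv hzs, inner_sub_left _ (B _), h4, sub_zero]
    refine h3.trans_isLittleO ?_
    refine IsBigO.trans_isLittleO ?_ (h1.mono nhdsWithin_le_nhds)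
    refine IsBigO.of_bound ‖u‖ (Eventually.of_forall fun z => ?_)
    rw [mul_comm]
    exact norm_inner_le_norm _ _
  · exact (Submodule.equivMapOfInjective (B : Euc D →ₗ[ℝ] Euc D) hinj _).finrank_eq.symm.trans
      (finrank_coordinateSubspace hd)

lemma IsSmoothSubmanifold.isTangentSpaceAt (hM : IsSmoothSubmanifold d M) (hd : d ≤ D)
    (hp : p ∈ M) : IsTangentSpaceAt M p (tangentSpaceAt M p) := by
  obtain ⟨T, hT, -⟩ := hM.exists_isTangentSpaceAt hd hp
  rwa [tangentSpaceAt, hT.span_tangentConeAt_eq]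

lemma IsSmoothSubmanifold.finrank_tangentSpaceAt (hM : IsSmoothSubmanifold d M) (hd : d ≤ D)
    (hp : p ∈ M) : Module.finrank ℝ (tangentSpaceAt M p) = d := by
  obtain ⟨T, hT, h⟩ := hM.exists_isTangentSpaceAt hd hp
  rwa [tangentSpaceAt, hT.span_tangentConeAt_eq]

end TangentSpaces

/-! ### Federer's inequality and tangent spaces under positive reach. -/

section PositiveReach

open Filter Asymptotics Metric
open scoped Topology

/-- A one-sided first-order bound suffices, because curves with velocities `v` and `-v` are both
available. -/
lemma IsTangentSpaceAt.mem_orthogonal {E : Type*} [NormedAddCommGroup E] [InnerProductSpace ℝ E]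
    {M : Set E} {p ν : E} {T : Submodule ℝ E} (hT : IsTangentSpaceAt M p T)
    (h : ∀ η > 0, ∀ᶠ z in 𝓝[M] p, inner ℝ (z - p) ν ≤ η * ‖z - p‖) : ν ∈ Tᗮ := by
  have key : ∀ v ∈ T, inner ℝ v ν ≤ 0 := by
    intro v hv
    obtain ⟨γ, h0, hd, hM⟩ := hT.exists_curve v hv
    have hlim : Tendsto (fun t : ℝ => t⁻¹ • (γ t - p)) (𝓝[>] 0) (𝓝 v) := by
      have := (hasDerivAt_iff_tendsto_slope.1 hd).mono_left
        (nhdsWithin_mono 0 (fun t ht => ne_of_gt ht : Set.Ioi (0 : ℝ) ⊆ {0}ᶜ))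
      refine this.congr fun t => ?_
      simp [slope_def_module, h0]
    have hγ : Tendsto γ (𝓝[>] 0) (𝓝[M] p) := by
      refine tendsto_nhdsWithin_iff.2 ⟨?_, hM.filter_mono nhdsWithin_le_nhds⟩
      have := hd.continuousAt.tendsto
      rw [h0] at this
      exact this.mono_left nhdsWithin_le_nhds
    refine le_of_forall_pos_le_add fun ε hε => ?_
    have h1 : inner ℝ v ν ≤ ε / (‖v‖ + 1) * ‖v‖ := by
      refine le_of_tendsto_of_tendsto (hlim.inner tendsto_const_nhds)
        (hlim.norm.const_mul _) ?_
      filter_upwards [hγ.eventually (h (ε / (‖v‖ + 1)) (by positivity)), self_mem_nhdsWithin]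
        with t ht ht0
      have ht1 : (0 : ℝ) < t⁻¹ := inv_pos.2 ht0
      rw [inner_smul_left, norm_smul, Real.norm_of_nonneg ht1.le]
      simp only [conj_trivial]
      nlinarith
    have h2 : ε / (‖v‖ + 1) * ‖v‖ ≤ ε := by
      rw [div_mul_eq_mul_div, div_le_iff₀ (by positivity)]
      nlinarith [norm_nonneg v]
    linarith
  rw [Submodule.mem_orthogonal]
  intro v hv
  have h1 := key v hv
  have h2 := key (-v) (T.neg_mem hv)
  rw [inner_neg_left] at h2
  linarith

lemma IsTangentSpaceAt.mem_orthogonal_of_quadratic {E : Type*} [NormedAddCommGroup E]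
    [InnerProductSpace ℝ E] {M : Set E} {p ν : E} {T : Submodule ℝ E}
    (hT : IsTangentSpaceAt M p T) {C : ℝ} (hC : 0 < C)
    (h : ∀ᶠ z in 𝓝[M] p, inner ℝ (z - p) ν ≤ C * ‖z - p‖ ^ 2) : ν ∈ Tᗮ := by
  refine hT.mem_orthogonal fun η hη => ?_
  filter_upwards [h, mem_nhdsWithin_of_mem_nhds (ball_mem_nhds p (div_pos hη hC))] with z hz hzb
  rw [mem_ball, dist_eq_norm, lt_div_iff₀ hC] at hzb
  nlinarith [norm_nonneg (z - p)]

/-- A compact connected `d`-dimensional set with tangent spaces whose tube of radius `κ` has unique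
projections. -/
structure IsRegularManifold {D : ℕ} (d : ℕ) (κ : ℝ) (M : Set (Euc D)) : Prop where
  isCompact : IsCompact M
  isConnected : IsConnected M
  unique : UniqueNearestWithin M κ
  isTangentSpaceAt : ∀ p ∈ M, IsTangentSpaceAt M p (tangentSpaceAt M p)
  finrank_eq : ∀ p ∈ M, Module.finrank ℝ (tangentSpaceAt M p) = d

namespace IsRegularManifold

variable {d D : ℕ} {κ : ℝ} {M : Set (Euc D)} {p q z x u v w ν : Euc D}

lemma nonempty (h : IsRegularManifold d κ M) : M.Nonempty := h.isConnected.nonempty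

lemma sub_mem_orthogonal_of_nearest (h : IsRegularManifold d κ M) (hp : p ∈ M)
    (hxp : dist x p = infDist x M) : x - p ∈ (tangentSpaceAt M p)ᗮ := by
  refine (h.isTangentSpaceAt p hp).mem_orthogonal_of_quadratic (C := 1 / 2) (by norm_num) ?_
  filter_upwards [self_mem_nhdsWithin] with z hz
  have h1 : ‖x - p‖ ≤ ‖x - z‖ := by
    rw [← dist_eq_norm, ← dist_eq_norm, hxp]; exact infDist_le_dist_of_mem hz
  have h2 : ‖x - p‖ ^ 2 ≤ ‖x - z‖ ^ 2 := by gcongr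
  have h3 : x - z = (x - p) - (z - p) := by abel
  rw [h3, norm_sub_sq_real (x - p), real_inner_comm] at h2
  linarith

/-- Federer's inequality: `M` does not enter the balls of radius `κ` tangent to `M`. -/
lemma inner_le_of_mem_orthogonal (h : IsRegularManifold d κ M) (hκ : 0 < κ) (hp : p ∈ M)
    (hu : u ∈ (tangentSpaceAt M p)ᗮ) (hz : z ∈ M) :
    2 * κ * inner ℝ (z - p) u ≤ ‖u‖ * ‖z - p‖ ^ 2 := by
  -- It is not known yet that `p` is the nearest point of `p + t • u`. The actual nearest points `P
  -- t` are used instead, and `t → 0`.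
  choose P hPM hP using fun t : ℝ => h.isCompact.exists_infDist_eq_dist h.nonempty (p + t • u)
  have hle : ∀ t > 0, ‖p + t • u - P t‖ ≤ t * ‖u‖ := by
    intro t ht
    rw [← dist_eq_norm, ← hP t]
    refine (infDist_le_dist_of_mem hp).trans ?_
    rw [dist_eq_norm, add_sub_cancel_left, norm_smul, Real.norm_of_nonneg ht.le]
  have hdiff : ∀ t, p + t • u - P t = t • u - (P t - p) := fun t => by abel
  have hsq : ∀ t > 0, ‖P t - p‖ ^ 2 ≤ 2 * t * inner ℝ (P t - p) u := by
    intro t ht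
    have h1 : ‖p + t • u - P t‖ ^ 2 ≤ (t * ‖u‖) ^ 2 := by gcongr; exact hle t ht
    rw [hdiff, norm_sub_sq_real, norm_smul, Real.norm_of_nonneg ht.le, inner_smul_left,
      real_inner_comm] at h1
    simp only [conj_trivial] at h1
    linarith
  have hbd : ∀ t > 0, ‖P t - p‖ ≤ 2 * t * ‖u‖ := by
    intro t ht
    have h1 := hsq t ht
    have h2 := real_inner_le_norm (P t - p) u
    have h3 : 0 ≤ 2 * t * ‖u‖ := by positivity
    by_contra hlt
    rw [not_le] at hlt
    nlinarith [norm_nonneg (P t - p)]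
  have hid : Tendsto (fun t : ℝ => t) (𝓝[>] 0) (𝓝 0) := tendsto_id.mono_left nhdsWithin_le_nhds
  have hPp : Tendsto P (𝓝[>] 0) (𝓝 p) := by
    rw [tendsto_iff_norm_sub_tendsto_zero]
    refine squeeze_zero' (Eventually.of_forall fun t => norm_nonneg _)
      (eventually_mem_nhdsWithin.mono fun t ht => hbd t ht) ?_
    simpa using (hid.const_mul 2).mul_const ‖u‖
  have hPM' : Tendsto P (𝓝[>] 0) (𝓝[M] p) :=
    tendsto_nhdsWithin_iff.2 ⟨hPp, Eventually.of_forall hPM⟩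
  -- `hsq` bounds `‖P t - p‖ ^ 2` by `2 t` times a normal component, which is `o(‖P t - p‖)` as `P t
  -- ∈ M`; hence `P t - p = o(t)`.
  have hsmall : Tendsto (fun t : ℝ => t⁻¹ • (P t - p)) (𝓝[>] 0) (𝓝 0) := by
    have ho := ((h.isTangentSpaceAt p hp).inner_isLittleO u hu).comp_tendsto hPM'
    rw [tendsto_zero_iff_norm_tendsto_zero, Metric.tendsto_nhds]
    intro ε hε
    filter_upwards [ho.def (show (0 : ℝ) < ε / 4 by positivity), self_mem_nhdsWithin] with t ht ht0
    have ht0' : (0 : ℝ) < t := ht0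
    simp only [Function.comp_apply] at ht
    have h1 := hsq t ht0
    have h2 := (Real.le_norm_self _).trans ht
    rw [norm_smul, norm_inv, Real.norm_of_nonneg ht0'.le, dist_zero_right,
      Real.norm_of_nonneg (by positivity), inv_mul_lt_iff₀ ht0']
    rcases (norm_nonneg (P t - p)).eq_or_lt with h0 | h0
    · rw [← h0]; positivity
    · have h3 : ‖P t - p‖ * ‖P t - p‖ ≤ (2 * t * (ε / 4)) * ‖P t - p‖ := by nlinarith
      have := le_of_mul_le_mul_right h3 h0
      nlinarith
  -- The touching-ball inequality at `P t`, divided by `t`, passes to the limit.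
  have hl : Tendsto (fun t : ℝ => 2 * κ * inner ℝ (z - P t) (u - t⁻¹ • (P t - p))) (𝓝[>] 0)
      (𝓝 (2 * κ * inner ℝ (z - p) u)) := by
    have := ((tendsto_const_nhds (x := z)).sub hPp).inner (𝕜 := ℝ)
      ((tendsto_const_nhds (x := u)).sub hsmall)
    rw [sub_zero] at this
    exact this.const_mul _
  have hr : Tendsto (fun t : ℝ => ‖u‖ * ‖z - P t‖ ^ 2) (𝓝[>] 0) (𝓝 (‖u‖ * ‖z - p‖ ^ 2)) :=
    ((((tendsto_const_nhds (x := z)).sub hPp).norm).pow 2).const_mul _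
  refine le_of_tendsto_of_tendsto hl hr ?_
  filter_upwards [Ioo_mem_nhdsGT (show 0 < κ / (‖u‖ + 1) by positivity)] with t ht
  have htu : t * ‖u‖ < κ := by
    have := ht.2
    rw [lt_div_iff₀ (by positivity)] at this
    nlinarith [ht.1]
  have h1 : infDist (p + t • u) M ≤ t * ‖u‖ := by
    rw [hP t, dist_eq_norm]; exact hle t ht.1
  have h2 : 2 * κ * inner ℝ (z - P t) (p + t • u - P t) ≤
      infDist (p + t • u) M * ‖z - P t‖ ^ 2 := by
    rcases (infDist_nonneg (x := p + t • u) (s := M)).eq_or_lt with h0 | h0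
    · have : p + t • u - P t = 0 := by
        rw [← norm_eq_zero, ← dist_eq_norm, ← hP t, h0]
      rw [this, inner_zero_right, ← h0]; simp
    · exact inner_le_of_nearest h.isCompact h.unique (hPM t) (hP t).symm h0
        (h1.trans_lt htu) hz
  have h3 : p + t • u - P t = t • (u - t⁻¹ • (P t - p)) := by
    rw [smul_sub, smul_inv_smul₀ ht.1.ne', hdiff]
  rw [h3, inner_smul_right] at h2
  have h4 : infDist (p + t • u) M * ‖z - P t‖ ^ 2 ≤ t * ‖u‖ * ‖z - P t‖ ^ 2 := by gcongr
  have ht0 := ht.1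
  refine le_of_mul_le_mul_left ?_ ht0
  linarith

lemma abs_inner_le_of_mem_orthogonal (h : IsRegularManifold d κ M) (hκ : 0 < κ) (hp : p ∈ M)
    (hu : u ∈ (tangentSpaceAt M p)ᗮ) (hz : z ∈ M) :
    2 * κ * |inner ℝ (z - p) u| ≤ ‖u‖ * ‖z - p‖ ^ 2 := by
  rcases abs_choice (inner ℝ (z - p) u) with h1 | h1
  · rw [h1]; exact h.inner_le_of_mem_orthogonal hκ hp hu hz
  · rw [h1, ← inner_neg_right, ← norm_neg u]
    exact h.inner_le_of_mem_orthogonal hκ hp (Submodule.neg_mem _ hu) hz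

/-- Federer's inequality with `u` the normal component of `z - p` itself. -/
lemma norm_sub_starProjection_le (h : IsRegularManifold d κ M) (hκ : 0 < κ) (hp : p ∈ M)
    (hz : z ∈ M) :
    2 * κ * ‖z - p - (tangentSpaceAt M p).starProjection (z - p)‖ ≤ ‖z - p‖ ^ 2 := by
  set T := tangentSpaceAt M p
  set u := z - p - T.starProjection (z - p) with hu
  have hu' : u ∈ Tᗮ := Submodule.sub_starProjection_mem_orthogonal _
  have h1 := h.inner_le_of_mem_orthogonal hκ hp hu' hz
  have h2 : inner ℝ (z - p) u = ‖u‖ * ‖u‖ := by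
    have h3 : z - p = u + T.starProjection (z - p) := by rw [hu]; abel
    have h4 : inner ℝ (T.starProjection (z - p)) u = 0 :=
      (Submodule.mem_orthogonal _ _).1 hu' _ (Submodule.starProjection_apply_mem _ _)
    rw [h3, inner_add_left, h4, add_zero, real_inner_self_eq_norm_mul_norm]
  rcases (norm_nonneg u).eq_or_lt with h0 | h0
  · rw [← h0]; simp
  · rw [h2] at h1
    refine le_of_mul_le_mul_left ?_ h0
    linarith

/-- If no direction of `T_p M` is normal to `M` at a point of the ball of radius `ρ` around `p`,
then the projection of this part of `M` to `T_p M` covers the ball of radius `ρ / 4`. -/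
lemma exists_starProjection_eq_of_transversal (h : IsRegularManifold d κ M) (hκ : 0 < κ)
    (hp : p ∈ M) {ρ : ℝ} (hρ : 0 < ρ) (hρκ : ρ ≤ κ / 32)
    (htr : ∀ q ∈ M, ‖q - p‖ < ρ → ∀ ν ∈ tangentSpaceAt M p, ν ∈ (tangentSpaceAt M q)ᗮ → ν = 0)
    (hw : w ∈ tangentSpaceAt M p) (hwρ : ‖w‖ ≤ ρ / 4) :
    ∃ z ∈ M, ‖z - p‖ < ρ ∧ (tangentSpaceAt M p).starProjection (z - p) = w := by
  set T := tangentSpaceAt M p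
  obtain ⟨z, ⟨hzM, hzb⟩, hmin⟩ := (h.isCompact.inter_right (isClosed_closedBall (x := p)
    (ε := ρ))).exists_isMinOn ⟨p, hp, mem_closedBall_self hρ.le⟩
    (f := fun z => ‖T.starProjection (z - p) - w‖) (by fun_prop)
  have hzp : ‖z - p‖ ≤ ρ := by rw [← dist_eq_norm]; exact hzb
  have hzw : ‖T.starProjection (z - p) - w‖ ≤ ‖w‖ := by
    have := hmin ⟨hp, mem_closedBall_self hρ.le⟩
    simpa using this
  -- On the sphere, the normal part is at most `ρ² / (2κ) ≤ ρ / 64`, and the tangential part at most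
  -- `2‖w‖ ≤ ρ / 2`, which do not add up to `ρ`.
  have hint : ‖z - p‖ < ρ := by
    refine lt_of_le_of_ne hzp fun heq => ?_
    have h1 := h.norm_sub_starProjection_le hκ hp hzM
    have h2 : ‖z - p‖ ≤
        ‖z - p - T.starProjection (z - p)‖ + ‖T.starProjection (z - p) - w‖ + ‖w‖ := by
      refine le_trans (le_of_eq ?_) (norm_add₃_le)
      congr 1; abel
    rw [heq] at h1 h2
    have h3 : ρ / 2 ≤ ‖z - p - T.starProjection (z - p)‖ := by linarith
    nlinarith
  refine ⟨z, hzM, hint, ?_⟩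
  -- The residual `a` is tangent at `p` and, by minimality at an interior point, `-a` is normal to
  -- `M` at `z`. Transversality makes it vanish.
  set a := T.starProjection (z - p) - w with ha
  have haT : a ∈ T := T.sub_mem (Submodule.starProjection_apply_mem _ _) hw
  suffices h0 : -a = 0 by rw [neg_eq_zero] at h0; exact sub_eq_zero.1 h0
  refine htr z hzM hint _ (T.neg_mem haT) ?_
  refine (h.isTangentSpaceAt z hzM).mem_orthogonal_of_quadratic (C := 1 / 2) (by norm_num) ?_
  filter_upwards [self_mem_nhdsWithin, mem_nhdsWithin_of_mem_nhds
    (isOpen_ball.mem_nhds (show z ∈ ball p ρ by rwa [mem_ball, dist_eq_norm]))] with y hy hyb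
  have h1 : ‖a‖ ≤ ‖T.starProjection (y - p) - w‖ := hmin ⟨hy, ball_subset_closedBall hyb⟩
  have h2 : T.starProjection (y - p) - w = a + T.starProjection (y - z) := by
    have : y - p = (z - p) + (y - z) := by abel
    rw [this, map_add, ha]; abel
  have h3 : ‖a‖ ^ 2 ≤ ‖a + T.starProjection (y - z)‖ ^ 2 := by rw [← h2]; gcongr
  have h4 : inner ℝ a (T.starProjection (y - z)) = inner ℝ (y - z) a := by
    rw [← Submodule.inner_starProjection_left_eq_right, Submodule.starProjection_eq_self_iff.2 haT,
      real_inner_comm]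
  have h5 : ‖T.starProjection (y - z)‖ ^ 2 ≤ ‖y - z‖ ^ 2 := by
    gcongr; exact Submodule.norm_starProjection_apply_le _ _
  rw [norm_add_sq_real, h4] at h3
  rw [inner_neg_right]
  linarith

/-- Transversality in a ball around `p` bounds the angle to the tangent spaces on its boundary. -/
lemma inner_lt_half_of_transversal (h : IsRegularManifold d κ M) (hκ : 0 < κ)
    (hp : p ∈ M) (hq : q ∈ M) (hpq : ‖q - p‖ ≤ κ / 32) (hv : v ∈ tangentSpaceAt M p)
    (hν : ν ∈ (tangentSpaceAt M q)ᗮ) (hv1 : ‖v‖ = 1) (hν1 : ‖ν‖ = 1)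
    (htr : ∀ y ∈ M, ‖y - p‖ < ‖q - p‖ → ∀ ν ∈ tangentSpaceAt M p,
      ν ∈ (tangentSpaceAt M y)ᗮ → ν = 0) : inner ℝ v ν < 1 / 2 := by
  by_contra hlt
  rw [not_lt] at hlt
  have hρ0 : 0 < ‖q - p‖ := by
    refine lt_of_le_of_ne (norm_nonneg _) fun h0 => ?_
    have : q = p := sub_eq_zero.1 (norm_eq_zero.1 h0.symm)
    rw [this] at hν
    rw [(Submodule.mem_orthogonal _ _).1 hν v hv] at hlt
    norm_num at hlt
  -- `M` reaches a distance `ρ / 4` in the direction `v`. If `v` were steep at `q`, then `z`, `p`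
  -- and `q` would violate Federer's inequality.
  obtain ⟨z, hz, hzρ, hzw⟩ := h.exists_starProjection_eq_of_transversal hκ hp hρ0 hpq htr
    (w := (‖q - p‖ / 4) • v) (Submodule.smul_mem _ _ hv)
    (by rw [norm_smul, hv1, mul_one, Real.norm_of_nonneg (by positivity)])
  set ρ := ‖q - p‖ with hρ
  have e1 := h.inner_le_of_mem_orthogonal hκ hq hν hz
  have e2 := h.norm_sub_starProjection_le hκ hp hz
  have e3 : 2 * κ * inner ℝ (q - p) ν ≤ ρ ^ 2 := by
    have := h.inner_le_of_mem_orthogonal hκ hq (Submodule.neg_mem _ hν) hp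
    rw [norm_neg, hν1, one_mul, inner_neg_right, ← inner_neg_left, neg_sub, norm_sub_rev] at this
    exact this
  rw [hν1, one_mul] at e1
  rw [hzw] at e2
  have e4 : -inner ℝ (z - p - (ρ / 4) • v) ν ≤ ‖z - p - (ρ / 4) • v‖ := by
    have := abs_real_inner_le_norm (z - p - (ρ / 4) • v) ν
    rw [hν1, mul_one] at this
    exact (neg_le_abs _).trans this
  have e5 : (ρ / 4) * inner ℝ v ν = inner ℝ (z - q) ν + inner ℝ (q - p) ν
      - inner ℝ (z - p - (ρ / 4) • v) ν := by
    rw [← inner_add_left, ← inner_sub_left]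
    have : z - q + (q - p) - (z - p - (ρ / 4) • v) = (ρ / 4) • v := by abel
    rw [this, inner_smul_left]; simp
  have e6 : ‖z - q‖ ≤ 2 * ρ := by
    have : z - q = (z - p) - (q - p) := by abel
    rw [this]; exact (norm_sub_le _ _).trans (by linarith)
  have e7 : ‖z - q‖ ^ 2 ≤ (2 * ρ) ^ 2 := by gcongr
  have e8 : ‖z - p‖ ^ 2 ≤ ρ ^ 2 := by gcongr
  -- The three terms of `e5` contribute at most `(4 + 1 + 1) ρ² / (2κ)`. A cosine `≥ 1 / 2` would
  -- force `κ ≤ 24 ρ`, against `ρ ≤ κ / 32`.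
  have e9 : κ * (ρ / 4 * inner ℝ v ν) ≤ 3 * ρ ^ 2 := by rw [e5]; nlinarith
  have e10 : κ * (ρ / 4 * (1 / 2)) ≤ κ * (ρ / 4 * inner ℝ v ν) := by gcongr
  have e11 : κ * ρ ≤ 24 * ρ * ρ := by nlinarith
  have e12 : κ ≤ 24 * ρ := le_of_mul_le_mul_right e11 hρ0
  linarith

/-- No continuity of tangent spaces is at hand, so normality of `ν` at `q` is encoded by Federer's
inequality, a closed condition on `(q, ν)`. -/
lemma _root_.IsCompact.exists_isCompact_steep_triples (hM : IsCompact M) (T : Submodule ℝ (Euc D))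
    (p : Euc D) (κ : ℝ) :
    ∃ S : Set (Euc D × Euc D × Euc D), IsCompact S ∧
      ∀ q v ν, (q, v, ν) ∈ S ↔ (q ∈ M ∧ ‖v‖ = 1 ∧ ‖ν‖ = 1) ∧ v ∈ T ∧
        ‖q - p‖ ≤ κ / 32 ∧ 1 / 2 ≤ inner ℝ v ν ∧
        ∀ z ∈ M, 2 * κ * inner ℝ (z - q) ν ≤ ‖z - q‖ ^ 2 := by
  have h1 : IsClosed {x : Euc D × Euc D × Euc D | x.2.1 ∈ T} :=
    (Submodule.closed_of_finiteDimensional T).preimage (continuous_fst.comp continuous_snd)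
  have h2 : IsClosed {x : Euc D × Euc D × Euc D | ‖x.1 - p‖ ≤ κ / 32} :=
    isClosed_le (by fun_prop) continuous_const
  have h3 : IsClosed {x : Euc D × Euc D × Euc D | 1 / 2 ≤ inner ℝ x.2.1 x.2.2} :=
    isClosed_le continuous_const (by fun_prop)
  have h4 : IsClosed (⋂ z ∈ M, {x : Euc D × Euc D × Euc D |
      2 * κ * inner ℝ (z - x.1) x.2.2 ≤ ‖z - x.1‖ ^ 2}) :=
    isClosed_biInter fun z _ => isClosed_le (by fun_prop) (by fun_prop)
  refine ⟨_, (hM.prod ((isCompact_sphere (0 : Euc D) 1).prod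
    (isCompact_sphere (0 : Euc D) 1))).inter_right (h1.inter (h2.inter (h3.inter h4))),
    fun q v ν => ?_⟩
  simp only [Set.mem_inter_iff, Set.mem_prod, mem_sphere_iff_norm, sub_zero, Set.mem_iInter,
    Set.mem_ofPred_eq]

lemma _root_.IsCompact.exists_min_norm_fst_sub {E F G : Type*} [NormedAddCommGroup E]
    [TopologicalSpace F] [TopologicalSpace G] {S : Set (E × F × G)} (hS : IsCompact S)
    (hne : S.Nonempty) (p : E) :
    ∃ q v ν, (q, v, ν) ∈ S ∧ ∀ q' v' ν', (q', v', ν') ∈ S → ‖q - p‖ ≤ ‖q' - p‖ := by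
  have hcont : Continuous fun x : E × F × G => ‖x.1 - p‖ :=
    (continuous_fst.sub continuous_const).norm
  obtain ⟨x, hx, hmin⟩ := hS.exists_isMinOn hne hcont.continuousOn
  exact ⟨x.1, x.2.1, x.2.2, hx, fun q' v' ν' h => isMinOn_iff.1 hmin _ h⟩

/-- Tangent spaces at points that are close compared to the reach are at an angle of at most
`30` degrees. -/
lemma inner_le_half_of_mem_tangentSpaceAt (h : IsRegularManifold d κ M) (hκ : 0 < κ)
    (hp : p ∈ M) (hq : q ∈ M) (hpq : ‖q - p‖ ≤ κ / 32) (hv : v ∈ tangentSpaceAt M p)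
    (hν : ν ∈ (tangentSpaceAt M q)ᗮ) : inner ℝ v ν ≤ ‖v‖ * ‖ν‖ / 2 := by
  by_contra hlt
  rw [not_le] at hlt
  obtain ⟨S, hSc, hmemS⟩ := h.isCompact.exists_isCompact_steep_triples (tangentSpaceAt M p) p κ
  have hnorm : ∀ q ∈ M, ‖q - p‖ ≤ κ / 32 → ∀ v ∈ tangentSpaceAt M p,
      ∀ ν ∈ (tangentSpaceAt M q)ᗮ, ‖v‖ = 1 → ‖ν‖ = 1 → 1 / 2 ≤ inner ℝ v ν → (q, v, ν) ∈ S := by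
    intro q hq hqp v hv ν hν hv1 hν1 hvν
    refine (hmemS q v ν).2 ⟨⟨hq, hv1, hν1⟩, hv, hqp, hvν, fun z hz => ?_⟩
    have := h.inner_le_of_mem_orthogonal hκ hq hν hz
    rwa [hν1, one_mul] at this
  have hv0 : v ≠ 0 := by rintro rfl; simp at hlt
  have hν0 : ν ≠ 0 := by rintro rfl; simp at hlt
  have hv1 : ‖‖v‖⁻¹ • v‖ = 1 := norm_smul_inv_norm hv0
  have hν1 : ‖‖ν‖⁻¹ • ν‖ = 1 := norm_smul_inv_norm hν0
  have hne : S.Nonempty := by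
    refine ⟨_, hnorm q hq hpq _ (Submodule.smul_mem _ ‖v‖⁻¹ hv) _ (Submodule.smul_mem _ ‖ν‖⁻¹ hν)
      hv1 hν1 ?_⟩
    have h1 := norm_pos_iff.2 hv0
    have h2 := norm_pos_iff.2 hν0
    rw [inner_smul_left, inner_smul_right]
    simp only [conj_trivial]
    rw [← mul_assoc, ← mul_inv, ← div_eq_inv_mul, le_div_iff₀ (by positivity)]
    linarith
  -- Take a steep triple with base point closest to `p`. Any failure of transversality strictly
  -- closer to `p` gives a unit vector `ν` and hence a closer steep triple `(q, ν, ν)`.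
  obtain ⟨q', v', ν', hmem, hmin⟩ := hSc.exists_min_norm_fst_sub hne p
  obtain ⟨⟨hq', hv', hν'⟩, hv'T, hq'p, hvν', hF⟩ := (hmemS q' v' ν').1 hmem
  have hν'T : ν' ∈ (tangentSpaceAt M q')ᗮ := by
    refine (h.isTangentSpaceAt q' hq').mem_orthogonal_of_quadratic (C := 1 / (2 * κ))
      (by positivity) ?_
    filter_upwards [self_mem_nhdsWithin] with z hz
    rw [one_div, ← div_eq_inv_mul, le_div_iff₀ (by positivity)]
    linarith [hF z hz]
  suffices htr : ∀ y ∈ M, ‖y - p‖ < ‖q' - p‖ → ∀ ν ∈ tangentSpaceAt M p,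
      ν ∈ (tangentSpaceAt M y)ᗮ → ν = 0 from
    absurd hvν' (not_le.2 (h.inner_lt_half_of_transversal hκ hp hq' hq'p hv'T hν'T hv' hν' htr))
  intro q hq hqρ ν hν1 hν2
  by_contra hne
  have h1 : ‖‖ν‖⁻¹ • ν‖ = 1 := norm_smul_inv_norm hne
  have h5 : (1 : ℝ) / 2 ≤ inner ℝ (‖ν‖⁻¹ • ν) (‖ν‖⁻¹ • ν) := by
    rw [real_inner_self_eq_norm_sq, h1]; norm_num
  have h2 := hnorm q hq (hqρ.le.trans hq'p) (‖ν‖⁻¹ • ν) (Submodule.smul_mem _ ‖ν‖⁻¹ hν1)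
    (‖ν‖⁻¹ • ν) (Submodule.smul_mem _ ‖ν‖⁻¹ hν2) h1 h1 h5
  have h3 : ‖q' - p‖ ≤ ‖q - p‖ := hmin _ _ _ h2
  exact absurd hqρ (not_lt.2 h3)

/-- At scales below the reach, `M` projects onto a ball of its tangent space. -/
lemma exists_starProjection_eq (h : IsRegularManifold d κ M) (hκ : 0 < κ)
    (hp : p ∈ M) {ρ : ℝ} (hρ : 0 < ρ) (hρκ : ρ ≤ κ / 32)
    (hw : w ∈ tangentSpaceAt M p) (hwρ : ‖w‖ ≤ ρ / 4) :
    ∃ z ∈ M, ‖z - p‖ < ρ ∧ (tangentSpaceAt M p).starProjection (z - p) = w := by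
  refine h.exists_starProjection_eq_of_transversal hκ hp hρ hρκ (fun q hq hqρ ν h1 h2 => ?_) hw hwρ
  have := h.inner_le_half_of_mem_tangentSpaceAt hκ hp hq (hqρ.le.trans hρκ) h1 h2
  rw [real_inner_self_eq_norm_mul_norm] at this
  have h0 : ‖ν‖ * ‖ν‖ = 0 := le_antisymm (by linarith) (by positivity)
  exact norm_eq_zero.1 (mul_self_eq_zero.1 h0)

/-- The projection of `M` to a tangent space is bi-Lipschitz at scales below the reach. -/
lemma norm_sub_le_two_mul_norm_starProjection (h : IsRegularManifold d κ M) (hκ : 0 < κ)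
    (hp : p ∈ M) {y : Euc D} (hy : y ∈ M) (hyp : ‖y - p‖ ≤ κ / 32) (hz : z ∈ M)
    (hyz : ‖z - y‖ ≤ κ / 4) :
    ‖z - y‖ ≤ 2 * ‖(tangentSpaceAt M p).starProjection (z - y)‖ := by
  set T := tangentSpaceAt M p
  set τ := (tangentSpaceAt M y).starProjection (z - y) with hτ
  set ν := z - y - T.starProjection (z - y) with hν
  have hνT : ν ∈ Tᗮ := Submodule.sub_starProjection_mem_orthogonal _
  have h1 := h.norm_sub_starProjection_le hκ hy hz
  have h2 : inner ℝ τ ν ≤ ‖τ‖ * ‖ν‖ / 2 :=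
    h.inner_le_half_of_mem_tangentSpaceAt hκ hy hp (by rwa [norm_sub_rev])
      (Submodule.starProjection_apply_mem _ _) hνT
  have h3 : ‖τ‖ ≤ ‖z - y‖ := Submodule.norm_starProjection_apply_le _ _
  have h4 : inner ℝ (z - y) ν = ‖ν‖ * ‖ν‖ := by
    have h5 : z - y = ν + T.starProjection (z - y) := by rw [hν]; abel
    have h6 : inner ℝ (T.starProjection (z - y)) ν = 0 :=
      (Submodule.mem_orthogonal _ _).1 hνT _ (Submodule.starProjection_apply_mem _ _)
    rw [h5, inner_add_left, h6, add_zero, real_inner_self_eq_norm_mul_norm]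
  have h5 : inner ℝ (z - y) ν = inner ℝ τ ν + inner ℝ (z - y - τ) ν := by
    rw [← inner_add_left]; congr 1; abel
  have h6 := real_inner_le_norm (z - y - τ) ν
  have h7 : ‖z - y - τ‖ ≤ ‖z - y‖ / 8 := by
    have : 2 * κ * ‖z - y - τ‖ ≤ 2 * κ * (‖z - y‖ / 8) := by nlinarith [norm_nonneg (z - y)]
    exact le_of_mul_le_mul_left this (by positivity)
  -- The tangential part at `y` contributes `1 / 2` by the angle bound, and the curvature remainder
  -- `1 / 8`. Pythagoras then leaves more than half of the norm for the projection.
  have h8 : ‖ν‖ ≤ 5 / 8 * ‖z - y‖ := by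
    rcases (norm_nonneg ν).eq_or_lt with h0 | h0
    · rw [← h0]; positivity
    · refine le_of_mul_le_mul_right ?_ h0
      nlinarith
  have h9 : ‖z - y‖ ^ 2 = ‖T.starProjection (z - y)‖ ^ 2 + ‖ν‖ ^ 2 := by
    have h5 : z - y = T.starProjection (z - y) + ν := by rw [hν]; abel
    have h6 : inner ℝ (T.starProjection (z - y)) ν = 0 :=
      (Submodule.mem_orthogonal _ _).1 hνT _ (Submodule.starProjection_apply_mem _ _)
    conv_lhs => rw [h5, norm_add_sq_real, h6]
    ring
  have h10 : ‖ν‖ ^ 2 ≤ (5 / 8 * ‖z - y‖) ^ 2 := by gcongr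
  refine le_of_sq_le_sq ?_ (by positivity)
  nlinarith [sq_nonneg ‖z - y‖]

end IsRegularManifold

end PositiveReach

/-! ### Volume of balls in manifolds of positive reach. -/

section Volume

open Metric

/-- The volume of the unit ball of `ℝ^d` for the `d`-dimensional Hausdorff measure. -/
noncomputable def unitBallVolume (d : ℕ) : ℝ :=
  (μH[d] (ball (0 : EuclideanSpace ℝ (Fin d)) 1)).toReal

lemma ofReal_unitBallVolume (d : ℕ) :
    ENNReal.ofReal (unitBallVolume d) = μH[d] (ball (0 : EuclideanSpace ℝ (Fin d)) 1) := by
  have : (μH[d] : Measure (EuclideanSpace ℝ (Fin d))).IsAddHaarMeasure := by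
    simpa using isAddHaarMeasure_hausdorffMeasure (E := EuclideanSpace ℝ (Fin d))
  exact ENNReal.ofReal_toReal measure_ball_lt_top.ne

lemma unitBallVolume_pos (d : ℕ) : 0 < unitBallVolume d := by
  have : (μH[d] : Measure (EuclideanSpace ℝ (Fin d))).IsAddHaarMeasure := by
    simpa using isAddHaarMeasure_hausdorffMeasure (E := EuclideanSpace ℝ (Fin d))
  exact ENNReal.toReal_pos (measure_ball_pos _ _ one_pos).ne' measure_ball_lt_top.ne

lemma hausdorffMeasure_ball_of_finrank_eq {E : Type*} [NormedAddCommGroup E]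
    [InnerProductSpace ℝ E] [FiniteDimensional ℝ E] [MeasurableSpace E] [BorelSpace E] {d : ℕ}
    (hd : Module.finrank ℝ E = d) (x : E) {r : ℝ} (hr : 0 < r) :
    μH[d] (ball x r) = ENNReal.ofReal (r ^ d * unitBallVolume d) := by
  have : (μH[d] : Measure E).IsAddHaarMeasure := by
    rw [← hd]; exact isAddHaarMeasure_hausdorffMeasure
  rw [Measure.addHaar_ball_of_pos _ _ hr, hd, ENNReal.ofReal_mul (by positivity),
    ofReal_unitBallVolume]
  congr 1
  have e := ((stdOrthonormalBasis ℝ E).reindex (finCongr hd)).repr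
  rw [← e.toIsometryEquiv.hausdorffMeasure_image]
  congr 1
  simp

namespace IsRegularManifold

variable {d D : ℕ} {κ : ℝ} {M : Set (Euc D)} {p : Euc D}

/-- Orthogonal projection to the tangent space does not increase Hausdorff measure, and its image
covers a ball of radius `ρ / 4`. -/
lemma le_hausdorffMeasure_inter_ball (h : IsRegularManifold d κ M) (hκ : 0 < κ) (hp : p ∈ M)
    {ρ : ℝ} (hρ : 0 < ρ) (hρκ : ρ ≤ κ / 32) :
    ENNReal.ofReal ((ρ / 4) ^ d * unitBallVolume d) ≤ μH[d] (M ∩ ball p ρ) := by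
  set T := tangentSpaceAt M p
  rw [← hausdorffMeasure_ball_of_finrank_eq (h.finrank_eq p hp) (T.orthogonalProjectionOnto p)
    (by positivity)]
  refine (measure_mono fun w hw => ?_).trans
    (hausdorffMeasure_orthogonalProjectionOnto_le T d (M ∩ ball p ρ) d.cast_nonneg)
  rw [mem_ball, dist_eq_norm] at hw
  obtain ⟨z, hz, hzρ, hzw⟩ := h.exists_starProjection_eq hκ hp hρ hρκ
    (w := ((w - T.orthogonalProjectionOnto p : T) : Euc D)) (Subtype.mem _) hw.le
  refine ⟨z, ⟨hz, by rwa [mem_ball, dist_eq_norm]⟩, ?_⟩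
  rw [Submodule.starProjection_apply, Subtype.coe_inj, map_sub] at hzw
  exact sub_left_injective hzw

/-- At this scale the projection to the tangent space has a 2-Lipschitz inverse, so the measure
grows by at most `2 ^ d` over that of a flat ball. -/
lemma hausdorffMeasure_inter_ball_le (h : IsRegularManifold d κ M) (hκ : 0 < κ) (hp : p ∈ M) :
    μH[d] (M ∩ ball p (κ / 32)) ≤ ENNReal.ofReal ((κ / 16) ^ d * unitBallVolume d) := by
  set T := tangentSpaceAt M p
  set s := M ∩ ball p (κ / 32) with hs
  set P : Euc D → T := fun z => T.orthogonalProjectionOnto z with hP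
  have hanti : ∀ y ∈ s, ∀ z ∈ s, dist z y ≤ 2 * dist (P z) (P y) := by
    intro y hy z hz
    have hy' := hy.2; have hz' := hz.2
    rw [mem_ball, dist_eq_norm] at hy' hz'
    have h1 : ‖z - y‖ ≤ κ / 4 := by
      have : z - y = (z - p) - (y - p) := by abel
      rw [this]; exact (norm_sub_le _ _).trans (by linarith)
    have h2 := h.norm_sub_le_two_mul_norm_starProjection hκ hp hy.1 hy'.le hz.1 h1
    rw [Submodule.starProjection_apply, map_sub] at h2
    rw [dist_eq_norm, dist_eq_norm]
    exact h2
  have hinj : Set.InjOn P s := by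
    intro y hy z hz hyz
    have := hanti z hz y hy
    rw [hyz, dist_self, mul_zero] at this
    exact dist_le_zero.1 this
  set g := Function.invFunOn P s with hg
  have hleft : ∀ y ∈ s, g (P y) = y := fun y hy => hinj.leftInvOn_invFunOn hy
  have hLip : LipschitzOnWith 2 g (P '' s) := by
    refine LipschitzOnWith.of_dist_le_mul ?_
    rintro _ ⟨z, hz, rfl⟩ _ ⟨y, hy, rfl⟩
    rw [hleft z hz, hleft y hy]
    simpa using hanti y hy z hz
  have himg : g '' (P '' s) = s := by
    rw [Set.image_image]
    exact (Set.image_congr hleft).trans (Set.image_id' s)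
  have hPs : P '' s ⊆ ball (P p) (κ / 32) := by
    rintro _ ⟨y, hy, rfl⟩
    have hy' := hy.2
    rw [mem_ball, dist_eq_norm] at hy' ⊢
    rw [hP]
    simp only
    rw [← map_sub]
    exact (T.norm_orthogonalProjectionOnto_apply_le _).trans_lt hy'
  calc μH[d] s = μH[d] (g '' (P '' s)) := by rw [himg]
    _ ≤ (2 : ℝ≥0∞) ^ (d : ℝ) * μH[d] (P '' s) := by
        simpa using hLip.hausdorffMeasure_image_le d.cast_nonneg
    _ ≤ (2 : ℝ≥0∞) ^ (d : ℝ) * μH[d] (ball (P p) (κ / 32)) := by gcongr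
    _ = ENNReal.ofReal ((κ / 16) ^ d * unitBallVolume d) := by
        rw [hausdorffMeasure_ball_of_finrank_eq (h.finrank_eq p hp) _ (by positivity),
          ENNReal.rpow_natCast, ← ENNReal.ofReal_ofNat, ← ENNReal.ofReal_pow (by norm_num),
          ← ENNReal.ofReal_mul (by positivity), ← mul_assoc, ← mul_pow]
        congr 3; ring

/-- The volume of the manifolds in a compact set is bounded uniformly. -/
lemma exists_hausdorffMeasure_le (d : ℕ) (hκ : 0 < κ) {𝒦 : Set (Euc D)} (h𝒦 : IsCompact 𝒦) :
    ∃ C : ℝ, 0 < C ∧ ∀ M, IsRegularManifold d κ M → M ⊆ 𝒦 → μH[d] M ≤ ENNReal.ofReal C := by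
  -- The centres need not lie on `M`; radius `κ / 64` puts each nonempty piece in a ball of radius
  -- `κ / 32` about one of its own points.
  obtain ⟨F, hF𝒦, hF, hcov⟩ := h𝒦.finite_cover_balls (show 0 < κ / 64 by positivity)
  have hv := unitBallVolume_pos d
  have hA : 0 < (κ / 16) ^ d * unitBallVolume d := by positivity
  refine ⟨(hF.toFinset.card + 1) * ((κ / 16) ^ d * unitBallVolume d), by positivity,
    fun M hM hMK => ?_⟩
  have h1 : M ⊆ ⋃ c ∈ hF.toFinset, M ∩ ball c (κ / 64) := by
    intro x hx
    have := hcov (hMK hx)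
    simp only [Set.mem_iUnion] at this ⊢
    obtain ⟨c, hc, hxc⟩ := this
    exact ⟨c, hF.mem_toFinset.2 hc, hx, hxc⟩
  have h2 : ∀ c ∈ hF.toFinset, μH[d] (M ∩ ball c (κ / 64)) ≤
      ENNReal.ofReal ((κ / 16) ^ d * unitBallVolume d) := by
    intro c _
    rcases (M ∩ ball c (κ / 64)).eq_empty_or_nonempty with he | ⟨q, hq, hqc⟩
    · rw [he]; simp
    · refine (measure_mono ?_).trans (hM.hausdorffMeasure_inter_ball_le hκ hq)
      rintro x ⟨hx, hxc⟩
      refine ⟨hx, ?_⟩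
      rw [mem_ball] at *
      have := dist_triangle_right x q c
      linarith
  calc μH[d] M ≤ μH[d] (⋃ c ∈ hF.toFinset, M ∩ ball c (κ / 64)) := measure_mono h1
    _ ≤ ∑ c ∈ hF.toFinset, μH[d] (M ∩ ball c (κ / 64)) := measure_biUnion_finset_le _ _
    _ ≤ ∑ _c ∈ hF.toFinset, ENNReal.ofReal ((κ / 16) ^ d * unitBallVolume d) :=
        Finset.sum_le_sum h2
    _ = ENNReal.ofReal (hF.toFinset.card * ((κ / 16) ^ d * unitBallVolume d)) := by
        rw [Finset.sum_const, nsmul_eq_mul, ENNReal.ofReal_mul (Nat.cast_nonneg _),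
          ENNReal.ofReal_natCast]
    _ ≤ _ := by
        apply ENNReal.ofReal_le_ofReal
        nlinarith

/-- Distributions with density bounded below charge the balls of radius `ρ` centred on the
manifold with mass at least of order `ρ ^ d`. -/
lemma exists_le_measure_closedBall (d : ℕ) (hκ : 0 < κ) {𝒦 : Set (Euc D)} (h𝒦 : IsCompact 𝒦)
    {b : ℝ} (hb : 0 < b) :
    ∃ c : ℝ, 0 < c ∧ ∀ M, IsRegularManifold d κ M → M ⊆ 𝒦 → ∀ B, ∀ G ∈ densityClass d b B M,
      ∀ y ∈ M, ∀ ρ, 0 < ρ → ρ ≤ κ / 32 →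
        ENNReal.ofReal (c * ρ ^ d) ≤ G (M ∩ closedBall y ρ) := by
  obtain ⟨C, hC, hvol⟩ := exists_hausdorffMeasure_le d hκ h𝒦
  have hv := unitBallVolume_pos d
  refine ⟨b * (C⁻¹ * ((1 / 4) ^ d * unitBallVolume d)), by positivity, ?_⟩
  rintro M hM hMK B G ⟨-, g, hg, hgb, rfl⟩ y hy ρ hρ hρκ
  have hMm : MeasurableSet M := hM.isCompact.isClosed.measurableSet
  have hAm : MeasurableSet (M ∩ closedBall y ρ) := hMm.inter measurableSet_closedBall
  have h1 : ENNReal.ofReal (C⁻¹ * ((1 / 4) ^ d * unitBallVolume d) * ρ ^ d) ≤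
      uniformOnManifold d M (M ∩ closedBall y ρ) := by
    rw [uniformOnManifold, ProbabilityTheory.cond_apply hMm, ← Set.inter_assoc, Set.inter_self]
    have : C⁻¹ * ((1 / 4) ^ d * unitBallVolume d) * ρ ^ d =
        C⁻¹ * ((ρ / 4) ^ d * unitBallVolume d) := by
      rw [div_pow, div_pow, one_pow]; ring
    rw [this, ENNReal.ofReal_mul (by positivity), ENNReal.ofReal_inv_of_pos hC]
    gcongr
    · exact hvol M hM hMK
    · exact (hM.le_hausdorffMeasure_inter_ball hκ hy hρ hρκ).trans
        (measure_mono (by gcongr; exact ball_subset_closedBall))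
  rw [withDensity_apply _ hAm]
  calc ENNReal.ofReal (b * (C⁻¹ * ((1 / 4) ^ d * unitBallVolume d)) * ρ ^ d)
      = ENNReal.ofReal b * ENNReal.ofReal (C⁻¹ * ((1 / 4) ^ d * unitBallVolume d) * ρ ^ d) := by
        rw [← ENNReal.ofReal_mul hb.le]; congr 1; ring
    _ ≤ ENNReal.ofReal b * uniformOnManifold d M (M ∩ closedBall y ρ) := by gcongr
    _ = ∫⁻ _ in M ∩ closedBall y ρ, ENNReal.ofReal b ∂uniformOnManifold d M := by
        rw [setLIntegral_const]
    _ ≤ _ := setLIntegral_mono' hAm fun x hx => ENNReal.ofReal_le_ofReal (hgb x hx.1).1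

end IsRegularManifold

end Volume

/-! ### Size and shape of slabs. -/

section Slabs

variable {d D : ℕ} {ℓ₁ ℓ₂ : ℝ} {M : Set (Euc D)} {y z : Euc D} {S : Set (Euc D)}

lemma IsSlab.norm_sub_le (hS : IsSlab d ℓ₁ ℓ₂ M y S) {L : ℝ} (h₁ : ℓ₁ ≤ L) (h₂ : ℓ₂ ≤ L)
    (hz : z ∈ S) : ‖z - y‖ ≤ D * (L / 2) := by
  obtain ⟨e, -, rfl⟩ := hS
  calc ‖z - y‖ = ‖∑ i, inner ℝ (e i) (z - y) • e i‖ := by rw [e.sum_repr']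
    _ ≤ ∑ i : Fin D, ‖inner ℝ (e i) (z - y) • e i‖ := norm_sum_le _ _
    _ ≤ ∑ _i : Fin D, L / 2 := by
        refine Finset.sum_le_sum fun i _ => ?_
        rw [norm_smul, e.norm_eq_one, mul_one, Real.norm_eq_abs]
        refine (hz i).trans ?_
        split_ifs <;> linarith
    _ = D * (L / 2) := by simp

/-- The long sides span the tangent space, so only the short ones contribute along a normal `u`. -/
lemma IsSlab.abs_inner_le (hS : IsSlab d ℓ₁ ℓ₂ M y S) (h₂ : 0 ≤ ℓ₂) (hz : z ∈ S) {u : Euc D}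
    (hu : u ∈ (tangentSpaceAt M y)ᗮ) : |inner ℝ (z - y) u| ≤ ‖u‖ * (D * (ℓ₂ / 2)) := by
  obtain ⟨e, he, rfl⟩ := hS
  rw [← e.sum_inner_mul_inner]
  calc |∑ i, inner ℝ (z - y) (e i) * inner ℝ (e i) u|
      ≤ ∑ i, |inner ℝ (z - y) (e i) * inner ℝ (e i) u| := Finset.abs_sum_le_sum_abs _ _
    _ ≤ ∑ _i : Fin D, ℓ₂ / 2 * ‖u‖ := by
        refine Finset.sum_le_sum fun i _ => ?_
        by_cases hi : (i : ℕ) < d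
        · have : inner ℝ (e i) u = 0 :=
            (Submodule.mem_orthogonal _ _).1 hu _ (he ▸ Submodule.subset_span ⟨i, hi, rfl⟩)
          rw [this, mul_zero, abs_zero]
          positivity
        · rw [abs_mul]
          have h1 := hz i
          rw [if_neg hi, real_inner_comm] at h1
          have h2 := abs_real_inner_le_norm (e i) u
          rw [e.norm_eq_one, one_mul] at h2
          gcongr
    _ = ‖u‖ * (D * (ℓ₂ / 2)) := by simp; ring

lemma IsSlab.mem_of_norm_le (hS : IsSlab d ℓ₁ ℓ₂ M y S) (h₁ : ‖z - y‖ ≤ ℓ₁ / 2)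
    (h₂ : ‖z - y - (tangentSpaceAt M y).starProjection (z - y)‖ ≤ ℓ₂ / 2) : z ∈ S := by
  obtain ⟨e, he, rfl⟩ := hS
  intro i
  set T := tangentSpaceAt M y
  split_ifs with hi
  · have := abs_real_inner_le_norm (e i) (z - y)
    rw [e.norm_eq_one, one_mul] at this
    exact this.trans h₁
  · have hT : e i ∈ Tᗮ := by
      rw [Submodule.mem_orthogonal, ← he]
      intro x hx
      induction hx using Submodule.span_induction with
      | mem x hx =>
        obtain ⟨j, hj, rfl⟩ := hx
        exact e.inner_eq_zero fun hji => hi (hji ▸ hj)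
      | zero => simp
      | add x y _ _ hx hy => rw [inner_add_left, hx, hy, add_zero]
      | smul c x _ hx => rw [inner_smul_left, hx, mul_zero]
    have h3 : inner ℝ (e i) (z - y) = inner ℝ (e i) (z - y - T.starProjection (z - y)) := by
      rw [inner_sub_right (e i) (z - y), real_inner_comm (T.starProjection (z - y)),
        (Submodule.mem_orthogonal _ _).1 hT _ (Submodule.starProjection_apply_mem _ _), sub_zero]
    rw [h3]
    have := abs_real_inner_le_norm (e i) (z - y - T.starProjection (z - y))
    rw [e.norm_eq_one, one_mul] at this
    exact this.trans h₂

end Slabs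

/-! ### Comparing two manifolds: a flat neighbourhood that misses the other one. -/

namespace IsRegularManifold

open Filter Metric
open scoped Topology

variable {d D : ℕ} {κ ε : ℝ} {M M₀ : Set (Euc D)} {p x y : Euc D}

/-- By `infDist_sq_growth` the squared distance to `M₀` grows at least like `2⟨z - y, y - p⟩` to
first order, so a maximum on `M` excludes tangential growth. -/
lemma sub_mem_orthogonal_of_isMaxOn (h : IsRegularManifold d κ M) (h₀ : IsRegularManifold d κ M₀)
    (hy : y ∈ M) (hmax : IsMaxOn (fun z => infDist z M₀) M y) (hp : p ∈ M₀)
    (hyp : dist y p = infDist y M₀) (hκ : infDist y M₀ < κ) :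
    y - p ∈ (tangentSpaceAt M y)ᗮ := by
  refine (h.isTangentSpaceAt y hy).mem_orthogonal fun η hη => ?_
  have hu : ∀ q ∈ M₀, dist y q = infDist y M₀ → q = p := fun q hq hq' =>
    (h₀.unique y hκ).unique ⟨hq, hq'⟩ ⟨hp, hyp⟩
  obtain ⟨ρ, hρ, H⟩ := infDist_sq_growth h₀.isCompact hp hu (show 0 < 2 * η by positivity)
  filter_upwards [self_mem_nhdsWithin, mem_nhdsWithin_of_mem_nhds (ball_mem_nhds y hρ)]
    with z hz hzρ
  have h1 := H z hzρ
  have h2 : infDist z M₀ ≤ infDist y M₀ := hmax hz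
  have h3 : infDist z M₀ ^ 2 ≤ infDist y M₀ ^ 2 := by gcongr; exact infDist_nonneg
  linarith

/-- If `M` is close to `M₀`, its tangent spaces are close to those of `M₀` at nearby points. -/
lemma norm_sub_starProjection_le_of_close (h : IsRegularManifold d κ M)
    (h₀ : IsRegularManifold d κ M₀) (hκ : 0 < κ) (hε : ε ≤ κ / 4096)
    (hclose : ∀ y ∈ M, infDist y M₀ ≤ ε) (hy : y ∈ M) (hp : p ∈ M₀) (hyp : ‖y - p‖ ≤ ε)
    {v : Euc D} (hv : v ∈ tangentSpaceAt M y) :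
    ‖v - (tangentSpaceAt M₀ p).starProjection v‖ ≤ 3 / 8 * ‖v‖ := by
  set T₀ := tangentSpaceAt M₀ p
  rcases eq_or_ne v 0 with rfl | hv0
  · simp
  have hvpos := norm_pos_iff.2 hv0
  -- Length `κ / 128` is a quarter of `κ / 32`, so `t • v` is the projection of a point `z` of `M`;
  -- the point of `M₀` nearest to `z` shows that `t • v` is almost in `T₀`.
  set t := κ / 128 / ‖v‖ with ht
  have ht0 : 0 < t := by positivity
  have htv : ‖t • v‖ = κ / 128 := by
    rw [norm_smul, Real.norm_of_nonneg ht0.le, ht, div_mul_cancel₀ _ hvpos.ne']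
  obtain ⟨z, hz, hzρ, hzw⟩ := h.exists_starProjection_eq hκ hy (ρ := κ / 32) (by positivity) le_rfl
    (w := t • v) (Submodule.smul_mem _ _ hv) (by rw [htv]; linarith)
  obtain ⟨z₀, hz₀, hd⟩ := h₀.isCompact.exists_infDist_eq_dist h₀.nonempty z
  have h1 : ‖z - z₀‖ ≤ ε := by rw [← dist_eq_norm, ← hd]; exact hclose z hz
  have h2 := h.norm_sub_starProjection_le hκ hy hz
  rw [hzw] at h2
  have h3 := h₀.norm_sub_starProjection_le hκ hp hz₀
  have h4 : ‖z₀ - p‖ ≤ κ / 16 := by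
    have : z₀ - p = (z - y) - (z - z₀) + (y - p) := by abel
    rw [this]
    refine (norm_add_le _ _).trans ((add_le_add_left (norm_sub_le _ _) _).trans ?_)
    linarith
  have h5 : ‖z - y‖ ^ 2 ≤ (κ / 32) ^ 2 := by gcongr
  have h6 : ‖z₀ - p‖ ^ 2 ≤ (κ / 16) ^ 2 := by gcongr
  have h7 : ‖z - y - t • v‖ ≤ κ / 2048 := by
    refine le_of_mul_le_mul_left ?_ hκ
    nlinarith
  have h8 : ‖z₀ - p - T₀.starProjection (z₀ - p)‖ ≤ κ / 512 := by
    refine le_of_mul_le_mul_left ?_ hκ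
    nlinarith
  have h9 : ‖t • v - T₀.starProjection (t • v)‖ ≤ ‖t • v - T₀.starProjection (z₀ - p)‖ := by
    rw [Submodule.starProjection_minimal]
    exact ciInf_le ⟨0, by rintro _ ⟨i, rfl⟩; exact norm_nonneg _⟩
      (⟨_, Submodule.starProjection_apply_mem T₀ (z₀ - p)⟩ : T₀)
  -- With `ε ≤ κ / 4096` the sum is at most `3κ / 1024`, which is `3 / 8` of `κ / 128`.
  have h10 : ‖t • v - T₀.starProjection (z₀ - p)‖ ≤ κ / 2048 + ε + ε + κ / 512 := by
    have : t • v - T₀.starProjection (z₀ - p) = -(z - y - t • v) + (z - z₀) + -(y - p)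
        + (z₀ - p - T₀.starProjection (z₀ - p)) := by abel
    rw [this]
    refine (norm_add_le _ _).trans (add_le_add (norm_add₃_le.trans ?_) h8)
    rw [norm_neg, norm_neg]
    linarith
  have h11 : ‖t • v - T₀.starProjection (t • v)‖ = t * ‖v - T₀.starProjection v‖ := by
    rw [map_smul, ← smul_sub, norm_smul, Real.norm_of_nonneg ht0.le]
  have h12 : t * ‖v‖ = κ / 128 := by rw [← htv, norm_smul, Real.norm_of_nonneg ht0.le]
  refine le_of_mul_le_mul_left ?_ ht0
  rw [← h11]
  nlinarith

/-- A manifold in a small tube around `M₀` comes close to every point of `M₀`. -/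
lemma infDist_ne_of_close (h : IsRegularManifold d κ M)
    (h₀ : IsRegularManifold d κ M₀) (hκ : 0 < κ) (hε : ε ≤ κ / 4096)
    (hclose : ∀ y ∈ M, infDist y M₀ ≤ ε) (hx : x ∈ M₀) : infDist x M ≠ κ / 64 := by
  intro hxM
  obtain ⟨y, hy, hxy⟩ := h.isCompact.exists_infDist_eq_dist h.nonempty x
  obtain ⟨p, hp, hyp⟩ := h₀.isCompact.exists_infDist_eq_dist h₀.nonempty y
  have hyp' : ‖y - p‖ ≤ ε := by rw [← dist_eq_norm, ← hyp]; exact hclose y hy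
  have hn := h.sub_mem_orthogonal_of_nearest hy hxy.symm
  rw [hxM, dist_eq_norm] at hxy
  set T := tangentSpaceAt M y with hT
  set T₀ := tangentSpaceAt M₀ p with hT₀
  have hTT₀ : ∀ v ∈ T, ‖v - T₀.starProjection v‖ ≤ 3 / 8 * ‖v‖ := fun v hv =>
    h.norm_sub_starProjection_le_of_close h₀ hκ hε hclose hy hp hyp' hv
  -- As `3 / 8 < 1`, projecting `T` to `T₀` is injective, hence onto by equality of dimensions. So
  -- some `v ∈ T` has the same `T₀`-component as `x - p`, and it nearly equals `x - y`, although `x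
  -- - y` is normal to `T`.
  let f : T →ₗ[ℝ] T₀ := (T₀.orthogonalProjectionOnto : Euc D →ₗ[ℝ] T₀).comp T.subtype
  have hf : ∀ v : T, (f v : Euc D) = T₀.starProjection (v : Euc D) := fun v => rfl
  have hinj : Function.Injective f := by
    rw [injective_iff_map_eq_zero]
    intro v hv
    have h1 := hTT₀ v v.2
    rw [← hf, hv, Submodule.coe_zero, sub_zero] at h1
    have h2 := norm_nonneg (v : Euc D)
    have h3 : ‖(v : Euc D)‖ = 0 := by linarith
    exact Subtype.ext (norm_eq_zero.1 h3)
  have hsurj : Function.Surjective f :=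
    (LinearMap.injective_iff_surjective_of_finrank_eq_finrank
      ((h.finrank_eq y hy).trans (h₀.finrank_eq p hp).symm)).1 hinj
  obtain ⟨v, hv⟩ := hsurj ⟨T₀.starProjection (x - p), Submodule.starProjection_apply_mem _ _⟩
  have hv' : T₀.starProjection (v : Euc D) = T₀.starProjection (x - p) := by rw [← hf, hv]
  have e1 := hTT₀ v v.2
  rw [hv'] at e1
  have e2 := h₀.norm_sub_starProjection_le hκ hp hx
  have e3 : ‖x - p‖ ≤ κ / 32 := by
    have : x - p = (x - y) + (y - p) := by abel
    rw [this]
    refine (norm_add_le _ _).trans ?_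
    linarith
  have e4 : ‖x - p‖ ^ 2 ≤ (κ / 32) ^ 2 := by gcongr
  have e5 : ‖x - p - T₀.starProjection (x - p)‖ ≤ κ / 2048 := by
    refine le_of_mul_le_mul_left ?_ hκ
    nlinarith
  have e6 : ‖(x - y) - v‖ ≤ κ / 1024 + 3 / 8 * ‖(v : Euc D)‖ := by
    have : (x - y) - v = (x - p - T₀.starProjection (x - p)) + -(y - p)
        + -(v - T₀.starProjection (x - p)) := by abel
    rw [this]
    refine norm_add₃_le.trans ?_
    rw [norm_neg, norm_neg]
    linarith
  have e7 : ‖(x - y) - v‖ ^ 2 = (κ / 64) ^ 2 + ‖(v : Euc D)‖ ^ 2 := by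
    rw [norm_sub_sq_real, real_inner_comm, (Submodule.mem_orthogonal _ _).1 hn v v.2, ← hxy]
    ring
  have e8 : ‖(x - y) - v‖ ^ 2 ≤ (κ / 1024 + 3 / 8 * ‖(v : Euc D)‖) ^ 2 := by gcongr
  rw [e7] at e8
  nlinarith [sq_nonneg (κ - ‖(v : Euc D)‖), sq_nonneg ‖(v : Euc D)‖, norm_nonneg (v : Euc D),
    sq_nonneg (κ / 1024 - 3 / 8 * ‖(v : Euc D)‖), mul_pos hκ hκ]

/-- If `M` is at Hausdorff distance more than `ε` from `M₀`, then some flat neighbourhood of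
size of order `√ε × ε` of a point of `M` misses `M₀`. -/
lemma exists_disjoint_of_lt_hausdorffDist (h : IsRegularManifold d κ M)
    (h₀ : IsRegularManifold d κ M₀) (hκ : 0 < κ) (hε : 0 < ε) (hεκ : ε ≤ κ / 4096)
    (hH : ε < hausdorffDist M₀ M) {S : Euc D → Set (Euc D)}
    (hS₁ : ∀ y ∈ M, ∀ z ∈ S y, ‖z - y‖ ^ 2 ≤ κ * ε / 16)
    (hS₂ : ∀ y ∈ M, ∀ z ∈ S y, ∀ u ∈ (tangentSpaceAt M y)ᗮ, |inner ℝ (z - y) u| ≤ ‖u‖ * (ε / 8)) :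
    ∃ y ∈ M, Disjoint (S y) M₀ := by
  -- Here `δ` is the extremal distance, `s` the distance from a slab point to `y`, and `w` its
  -- distance to the opposite point `x` of `M₀`. Thinness of the slab makes the normal component at
  -- `x` at least `δ - ε / 8`, too large for Federer's inequality.
  have final : ∀ δ s w : ℝ, ε < δ → δ ≤ κ / 4 → w ^ 2 ≤ 2 * s ^ 2 + 2 * δ ^ 2 →
      s ^ 2 ≤ κ * ε / 16 → 2 * κ * (δ ^ 2 - δ * (ε / 8)) ≤ δ * w ^ 2 → False := by
    intro δ s w h1 h2 h3 h4 h5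
    have hδ : 0 < δ := hε.trans h1
    have h6 : δ * (2 * κ * (δ - ε / 8)) ≤ δ * w ^ 2 := by linarith
    have h7 := le_of_mul_le_mul_left h6 hδ
    have h8 : δ ^ 2 ≤ δ * (κ / 4) := by nlinarith
    nlinarith
  have hsq : ∀ a b c : Euc D, ‖a - c‖ ^ 2 ≤ 2 * ‖a - b‖ ^ 2 + 2 * ‖b - c‖ ^ 2 := by
    intro a b c
    have h1 : ‖a - c‖ ≤ ‖a - b‖ + ‖b - c‖ := norm_sub_le_norm_sub_add_norm_sub a b c
    nlinarith [norm_nonneg (a - c), sq_nonneg (‖a - b‖ - ‖b - c‖)]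
  by_cases hclose : ∀ y ∈ M, infDist y M₀ ≤ ε
  · obtain ⟨x₁, hx₁, hlt⟩ : ∃ x ∈ M₀, ε < infDist x M := by
      by_contra! hcon
      exact absurd hH (not_lt.2 (hausdorffDist_le_of_infDist hε.le hcon hclose))
    obtain ⟨x, hx, hmax⟩ := h₀.isCompact.exists_isMaxOn h₀.nonempty
      (continuous_infDist_pt M).continuousOn
    have hδε : ε < infDist x M := hlt.trans_le (hmax hx₁)
    by_cases hδκ : infDist x M ≤ κ / 4
    · obtain ⟨y, hy, hxy⟩ := h.isCompact.exists_infDist_eq_dist h.nonempty x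
      have hxy' : infDist x M = ‖x - y‖ := by rw [hxy, dist_eq_norm]
      have hu := h.sub_mem_orthogonal_of_nearest hy hxy.symm
      have hu₀ := h₀.sub_mem_orthogonal_of_isMaxOn h hx hmax hy hxy.symm (by linarith)
      refine ⟨y, hy, Set.disjoint_left.2 fun z hzS hz => ?_⟩
      refine final _ ‖z - y‖ ‖z - x‖ hδε hδκ ?_ (hS₁ y hy z hzS) ?_
      · rw [hxy', norm_sub_rev x y]; exact hsq z y x
      · have h1 := h₀.abs_inner_le_of_mem_orthogonal hκ hx hu₀ hz
        have h2 := hS₂ y hy z hzS _ hu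
        rw [← hxy'] at h1 h2
        have h3 : inner ℝ (z - x) (x - y) = inner ℝ (z - y) (x - y) - infDist x M ^ 2 := by
          rw [hxy', ← real_inner_self_eq_norm_sq, ← inner_sub_left]; congr 1; abel
        refine le_trans ?_ h1
        have h4 := neg_le_abs (inner ℝ (z - x) (x - y))
        have h5 := le_abs_self (inner ℝ (z - y) (x - y))
        gcongr
        linarith
    · exfalso
      obtain ⟨y, hy⟩ := h.nonempty
      obtain ⟨p, hp, hyp⟩ := h₀.isCompact.exists_infDist_eq_dist h₀.nonempty y
      have h1 : infDist p M ≤ ε := (infDist_le_dist_of_mem hy).trans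
        (by rw [dist_comm, ← hyp]; exact hclose y hy)
      -- The distance to `M` runs along the connected `M₀` from at most `ε` to above `κ / 4`, so it
      -- would take the excluded value `κ / 64`.
      obtain ⟨x', hx', hx'M⟩ := h₀.isConnected.isPreconnected.intermediate_value hp hx
        (continuous_infDist_pt M).continuousOn
        (show κ / 64 ∈ Set.Icc (infDist p M) (infDist x M) from ⟨by linarith, by linarith⟩)
      exact h.infDist_ne_of_close h₀ hκ hεκ hclose hx' hx'M
  · push Not at hclose
    obtain ⟨y₁, hy₁, hlt⟩ := hclose
    obtain ⟨y, hy, hmax⟩ := h.isCompact.exists_isMaxOn h.nonempty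
      (continuous_infDist_pt M₀).continuousOn
    have hδε : ε < infDist y M₀ := hlt.trans_le (hmax hy₁)
    refine ⟨y, hy, Set.disjoint_left.2 fun z hzS hz => ?_⟩
    by_cases hδκ : infDist y M₀ ≤ κ / 4
    · obtain ⟨x, hx, hxy⟩ := h₀.isCompact.exists_infDist_eq_dist h₀.nonempty y
      have hxy' : infDist y M₀ = ‖y - x‖ := by rw [hxy, dist_eq_norm]
      have hu₀ := h₀.sub_mem_orthogonal_of_nearest hx hxy.symm
      have hu := h.sub_mem_orthogonal_of_isMaxOn h₀ hy hmax hx hxy.symm (by linarith)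
      refine final _ ‖z - y‖ ‖z - x‖ hδε hδκ ?_ (hS₁ y hy z hzS) ?_
      · rw [hxy']; exact hsq z y x
      · have h1 := h₀.abs_inner_le_of_mem_orthogonal hκ hx hu₀ hz
        have h2 := hS₂ y hy z hzS _ hu
        rw [← hxy'] at h1 h2
        have h3 : inner ℝ (z - x) (y - x) = inner ℝ (z - y) (y - x) + infDist y M₀ ^ 2 := by
          rw [hxy', ← real_inner_self_eq_norm_sq, ← inner_add_left]; congr 1; abel
        refine le_trans ?_ h1
        have h4 := le_abs_self (inner ℝ (z - x) (y - x))
        have h5 := neg_le_abs (inner ℝ (z - y) (y - x))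
        gcongr
        linarith
    -- Here `M₀` is farther from `y` than the diameter of the slab allows.
    · have h1 : infDist y M₀ ≤ ‖z - y‖ := by
        rw [norm_sub_rev, ← dist_eq_norm]; exact infDist_le_dist_of_mem hz
      have h2 := hS₁ y hy z hzS
      rw [not_le] at hδκ
      nlinarith

end IsRegularManifold

/-! ### Nets of polynomial size. -/

section Nets

open Metric

/-- The subsets of a bounded set have `h`-nets of cardinality at most of order `h ^ (-D)`. -/
lemma exists_net {D : ℕ} {𝒦 : Set (Euc D)} (h𝒦 : Bornology.IsBounded 𝒦) :
    ∃ C : ℝ, 0 < C ∧ ∀ h : ℝ, 0 < h → h ≤ 1 → ∀ A ⊆ 𝒦, ∃ F : Finset (Euc D), ↑F ⊆ A ∧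
      (F.card : ℝ) ≤ C / h ^ D ∧ ∀ x ∈ A, ∃ p ∈ F, dist x p ≤ h := by
  classical
  obtain ⟨R, hR0, hR⟩ := h𝒦.exists_pos_norm_le
  refine ⟨(2 * (R * D) + 3) ^ D, by positivity, fun h hh0 hh1 A hA => ?_⟩
  -- Cubes of side `h / D` have diameter at most `h`. One point of `A` is kept from each occupied
  -- cube, so the net lies inside `A`.
  set cell : Euc D → Fin D → ℤ := fun x i => ⌊x i * (D / h)⌋ with hcell
  have hclose : ∀ x y, cell x = cell y → dist x y ≤ h := by
    intro x y hxy
    have hi : ∀ i : Fin D, |x i - y i| ≤ h / D := by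
      intro i
      have hD : (0 : ℝ) < D := by exact_mod_cast i.pos
      have h1 := Int.abs_sub_lt_one_of_floor_eq_floor (congrFun hxy i)
      rw [← sub_mul, abs_mul, abs_of_pos (show (0 : ℝ) < D / h by positivity)] at h1
      rw [le_div_iff₀ hD]
      rw [mul_div_assoc', div_lt_one hh0] at h1
      exact h1.le
    set e := EuclideanSpace.basisFun (Fin D) ℝ
    rw [dist_eq_norm, ← e.sum_repr (x - y)]
    refine (norm_sum_le _ _).trans ?_
    calc ∑ i, ‖e.repr (x - y) i • e i‖ ≤ ∑ _i : Fin D, h / D := by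
          refine Finset.sum_le_sum fun i _ => ?_
          rw [norm_smul, e.norm_eq_one, mul_one]
          exact hi i
      _ ≤ h := by
          rw [Finset.sum_const, Finset.card_univ, Fintype.card_fin, nsmul_eq_mul]
          rcases Nat.eq_zero_or_pos D with h0 | h0
          · simp [h0, hh0.le]
          · rw [mul_div_cancel₀]; exact_mod_cast h0.ne'
  set m : ℤ := ⌈R * D / h⌉ with hm
  have hm0 : 0 ≤ m := Int.ceil_nonneg (by positivity)
  set I : Finset (Fin D → ℤ) := Fintype.piFinset fun _ => Finset.Icc (-m) m with hI
  have hmem : ∀ x ∈ A, cell x ∈ I := by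
    intro x hx
    rw [hI, Fintype.mem_piFinset]
    intro i
    have h1 : |x i * (D / h)| ≤ m := by
      have h2 : |x i| ≤ R := (PiLp.norm_apply_le x i).trans (hR x (hA hx))
      rw [abs_mul, abs_of_nonneg (show (0 : ℝ) ≤ D / h by positivity)]
      calc |x i| * (D / h) ≤ R * (D / h) := by gcongr
        _ = R * D / h := by ring
        _ ≤ m := Int.le_ceil _
    rw [abs_le] at h1
    rw [Finset.mem_Icc]
    refine ⟨Int.le_floor.2 (by push_cast; exact h1.1), ?_⟩
    show ⌊x i * (D / h)⌋ ≤ m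
    exact Int.cast_le.1 ((Int.floor_le (x i * (D / h))).trans h1.2)
  have hcard : (I.card : ℝ) ≤ (2 * (R * D) + 3) ^ D / h ^ D := by
    rw [hI, Fintype.card_piFinset_const, Int.card_Icc, Nat.cast_pow, ← div_pow]
    gcongr
    have h1 : (((m + 1 - -m).toNat : ℕ) : ℝ) = 2 * m + 1 := by
      have : (((m + 1 - -m).toNat : ℤ) : ℝ) = ((2 * m + 1 : ℤ) : ℝ) := by
        rw [Int.toNat_of_nonneg (by linarith)]; congr 1; ring
      push_cast at this ⊢
      exact this
    rw [h1, le_div_iff₀ hh0]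
    have h2 : (m : ℝ) < R * D / h + 1 := Int.ceil_lt_add_one _
    have h3 : (m : ℝ) * h ≤ R * D + h := by
      calc (m : ℝ) * h ≤ (R * D / h + 1) * h := by gcongr
        _ = R * D + h := by field_simp
    linarith
  choose rep hrepA hrep using fun c : {c : Fin D → ℤ // ∃ x ∈ A, cell x = c} => c.2
  have key : ∃ r : (Fin D → ℤ) → Euc D, ∀ x ∈ A, r (cell x) ∈ A ∧ cell (r (cell x)) = cell x := by
    refine ⟨fun c => if hc : ∃ x ∈ A, cell x = c then rep ⟨c, hc⟩ else 0, fun x hx => ?_⟩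
    have hc : ∃ y ∈ A, cell y = cell x := ⟨x, hx, rfl⟩
    simp only [dif_pos hc]
    exact ⟨hrepA ⟨_, hc⟩, hrep ⟨_, hc⟩⟩
  obtain ⟨r, hr⟩ := key
  refine ⟨(I.filter fun c => ∃ x ∈ A, cell x = c).image r, ?_, ?_, fun x hx => ?_⟩
  · intro y hy
    simp only [Finset.coe_image, Set.mem_image, Finset.coe_filter, Set.mem_ofPred_eq] at hy
    obtain ⟨_, ⟨-, x, hx, rfl⟩, rfl⟩ := hy
    exact (hr x hx).1
  · refine le_trans ?_ hcard
    exact_mod_cast Finset.card_image_le.trans (Finset.card_filter_le _ _)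
  · refine ⟨r (cell x), Finset.mem_image_of_mem r ?_, hclose _ _ (hr x hx).2.symm⟩
    exact Finset.mem_filter.2 ⟨hmem x hx, x, hx, rfl⟩

end Nets

/-! ### Chernoff bounds, uniform over balls. -/

section Concentration

variable {D n : ℕ}

/-- The number of observations in `A`. -/
noncomputable def sampleCount (Y : Fin n → Euc D) (A : Set (Euc D)) : ℝ :=
  Nat.card {i : Fin n // Y i ∈ A}

lemma empiricalMass_eq (Y : Fin n → Euc D) (A : Set (Euc D)) :
    empiricalMass Y A = sampleCount Y A / n := rfl

lemma sampleCount_mono (Y : Fin n → Euc D) {A B : Set (Euc D)}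
    (h : ∀ i, Y i ∈ A → Y i ∈ B) : sampleCount Y A ≤ sampleCount Y B := by
  unfold sampleCount
  exact_mod_cast Nat.card_le_card_of_injective
    (fun i : {i : Fin n // Y i ∈ A} => (⟨i.1, h i.1 i.2⟩ : {i : Fin n // Y i ∈ B}))
    fun i j hij => Subtype.ext (congrArg (fun k : {i : Fin n // Y i ∈ B} => (k : Fin n)) hij)

/-- The exponential Markov inequality for the number of observations in `A`. -/
lemma sampleLaw_exp_markov (Q : Measure (Euc D)) [IsProbabilityMeasure Q] {A : Set (Euc D)}
    (hA : MeasurableSet A) (t m : ℝ) :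
    (sampleLaw Q n).real {Y | t * m ≤ t * sampleCount Y A} ≤
      Real.exp (-(t * m) + n * Q.real A * (Real.exp t - 1)) := by
  classical
  have hprob : IsProbabilityMeasure (sampleLaw Q n) := by unfold sampleLaw; infer_instance
  -- This is `exp (t 1_A)`, so independence factors the moment generating function of the count. The
  -- sign of `t` selects the tail.
  set f : Euc D → ℝ := fun x => A.indicator (fun _ => Real.exp t - 1) x + 1 with hf
  have hfm : Integrable f Q :=
    ((integrable_const _).indicator hA).add (integrable_const _)
  have hfint : ∫ x, f x ∂Q = Q.real A * (Real.exp t - 1) + 1 := by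
    rw [hf, integral_add ((integrable_const _).indicator hA) (integrable_const _),
      integral_indicator_const _ hA]
    simp
  have hprod : ∀ Y : Fin n → Euc D, ∏ i, f (Y i) = Real.exp (t * sampleCount Y A) := by
    intro Y
    have h1 : ∀ i, f (Y i) = if Y i ∈ A then Real.exp t else 1 := by
      intro i
      by_cases hi : Y i ∈ A <;> simp [hf, hi]
    simp only [h1]
    rw [Finset.prod_ite, Finset.prod_const, Finset.prod_const_one, mul_one, ← Real.exp_nat_mul,
      sampleCount, Nat.card_eq_fintype_card, Fintype.card_subtype, mul_comm]
  have hint : Integrable (fun Y : Fin n → Euc D => ∏ i, f (Y i)) (sampleLaw Q n) :=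
    Integrable.fintype_prod fun _ => hfm
  have hmk := mul_meas_ge_le_integral_of_nonneg (μ := sampleLaw Q n)
    (f := fun Y : Fin n → Euc D => ∏ i, f (Y i))
    (Filter.Eventually.of_forall fun Y => by
      show 0 ≤ ∏ i, f (Y i)
      rw [hprod]; positivity) hint (Real.exp (t * m))
  have hI : ∫ Y, ∏ i, f (Y i) ∂(sampleLaw Q n) = (Q.real A * (Real.exp t - 1) + 1) ^ n := by
    rw [sampleLaw, integral_fintype_prod_eq_pow, hfint, Fintype.card_fin]
  rw [hI] at hmk
  simp only [hprod, Real.exp_le_exp] at hmk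
  have h2 : (Q.real A * (Real.exp t - 1) + 1) ^ n ≤
      Real.exp (n * Q.real A * (Real.exp t - 1)) := by
    rw [mul_assoc, Real.exp_nat_mul]
    refine pow_le_pow_left₀ ?_ (Real.add_one_le_exp _) _
    have h3 : Q.real A ≤ 1 := measureReal_le_one
    have h4 : 0 ≤ Q.real A := measureReal_nonneg
    nlinarith [Real.exp_pos t]
  rw [Real.exp_add, Real.exp_neg, ← div_eq_inv_mul, le_div_iff₀' (Real.exp_pos _)]
  exact hmk.trans h2

/-- Take `t = 1`: as `e - 1 ≤ 2`, the exponent is at most `-m + 2 (m / 4)`. -/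
lemma sampleLaw_le_sampleCount_le (Q : Measure (Euc D)) [IsProbabilityMeasure Q]
    {A : Set (Euc D)} (hA : MeasurableSet A) {m : ℝ} (hm : n * Q.real A ≤ m / 4) :
    (sampleLaw Q n).real {Y | m ≤ sampleCount Y A} ≤ Real.exp (-m / 2) := by
  have h := sampleLaw_exp_markov (n := n) Q hA 1 m
  simp only [one_mul] at h
  refine h.trans (Real.exp_le_exp.2 ?_)
  have h1 : Real.exp 1 - 1 ≤ 2 := by linarith [Real.exp_one_lt_d9]
  have h2 : 0 ≤ n * Q.real A := by positivity
  nlinarith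

/-- Take `t = -1`: as `e⁻¹ - 1 ≤ -1 / 2`, the exponent is at most `m - (4 m) / 2`. -/
lemma sampleLaw_sampleCount_le (Q : Measure (Euc D)) [IsProbabilityMeasure Q]
    {A : Set (Euc D)} (hA : MeasurableSet A) {m : ℝ} (hm0 : 0 ≤ m) (hm : 4 * m ≤ n * Q.real A) :
    (sampleLaw Q n).real {Y | sampleCount Y A ≤ m} ≤ Real.exp (-m / 2) := by
  have h := sampleLaw_exp_markov (n := n) Q hA (-1) m
  simp only [neg_mul, one_mul, neg_le_neg_iff, neg_neg] at h
  refine h.trans (Real.exp_le_exp.2 ?_)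
  have h1 : Real.exp (-1) - 1 ≤ -(1 / 2) := by
    have h3 : (2 : ℝ) ≤ Real.exp 1 := by linarith [Real.add_one_le_exp (1 : ℝ)]
    have h4 : Real.exp (-1) ≤ 2⁻¹ := by rw [Real.exp_neg]; gcongr
    linarith
  have h2 : 0 ≤ n * Q.real A := by positivity
  nlinarith

open Metric in
/-- With high probability, all balls centred on `M` contain many observations, and all balls
contain few observations outside `M`. -/
lemma sampleLaw_uniform_deviation (Q : Measure (Euc D)) [IsProbabilityMeasure Q]
    {M 𝒦 : Set (Euc D)} (hM : MeasurableSet M) {τ h₁ h₂ N : ℝ} (hτ : 0 ≤ τ)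
    (hlow : ∀ y ∈ M, 4 * τ ≤ n * Q.real (M ∩ closedBall y h₁))
    (hup : ∀ y ∈ 𝒦, n * Q.real (closedBall y (2 * h₂) \ M) ≤ τ / 4)
    {F₁ F₂ : Finset (Euc D)} (hF₁ : ↑F₁ ⊆ M) (hF₂ : ↑F₂ ⊆ 𝒦)
    (hnet₁ : ∀ x ∈ M, ∃ p ∈ F₁, dist x p ≤ h₁) (hnet₂ : ∀ x ∈ 𝒦, ∃ p ∈ F₂, dist x p ≤ h₂)
    (hN : (F₁.card : ℝ) + F₂.card ≤ N) :
    (sampleLaw Q n).real {Y | ¬ ((∀ y ∈ M, τ < sampleCount Y (M ∩ closedBall y (2 * h₁))) ∧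
      ∀ y ∈ 𝒦, sampleCount Y (closedBall y h₂ \ M) < τ)} ≤ N * Real.exp (-τ / 2) := by
  have hprob : IsProbabilityMeasure (sampleLaw Q n) := by unfold sampleLaw; infer_instance
  set E₁ : Euc D → Set (Fin n → Euc D) :=
    fun p => {Y | sampleCount Y (M ∩ closedBall p h₁) ≤ τ} with hE₁
  set E₂ : Euc D → Set (Fin n → Euc D) :=
    fun p => {Y | τ ≤ sampleCount Y (closedBall p (2 * h₂) \ M)} with hE₂
  -- Moving to a net point costs a factor 2 in the radius: balls about net points are shrunk for the
  -- lower bound and enlarged for the upper one.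
  have hsub : {Y : Fin n → Euc D |
      ¬ ((∀ y ∈ M, τ < sampleCount Y (M ∩ closedBall y (2 * h₁))) ∧
        ∀ y ∈ 𝒦, sampleCount Y (closedBall y h₂ \ M) < τ)} ⊆
      (⋃ p ∈ F₁, E₁ p) ∪ ⋃ p ∈ F₂, E₂ p := by
    intro Y hY
    by_contra hcon
    simp only [Set.mem_union, Set.mem_iUnion, not_or, not_exists, hE₁, hE₂, Set.mem_ofPred_eq,
      not_le] at hcon
    refine hY ⟨fun y hy => ?_, fun y hy => ?_⟩
    · obtain ⟨p, hp, hyp⟩ := hnet₁ y hy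
      refine (hcon.1 p hp).trans_le (sampleCount_mono Y fun i hi => ⟨hi.1, ?_⟩)
      have h1 := hi.2
      rw [mem_closedBall] at h1 ⊢
      have := dist_triangle_right (Y i) y p
      linarith
    · obtain ⟨p, hp, hyp⟩ := hnet₂ y hy
      refine (sampleCount_mono Y (B := closedBall p (2 * h₂) \ M)
        fun i hi => ⟨?_, hi.2⟩).trans_lt (hcon.2 p hp)
      have h1 := hi.1
      rw [mem_closedBall] at h1 ⊢
      have := dist_triangle (Y i) y p
      linarith
  refine (measureReal_mono hsub).trans ((measureReal_union_le _ _).trans ?_)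
  have hb₁ : (sampleLaw Q n).real (⋃ p ∈ F₁, E₁ p) ≤ F₁.card * Real.exp (-τ / 2) := by
    refine (measureReal_biUnion_finset_le _ _).trans ?_
    rw [← nsmul_eq_mul]
    refine Finset.sum_le_card_nsmul _ _ _ fun p hp => ?_
    exact sampleLaw_sampleCount_le Q (hM.inter measurableSet_closedBall) hτ (hlow p (hF₁ hp))
  have hb₂ : (sampleLaw Q n).real (⋃ p ∈ F₂, E₂ p) ≤ F₂.card * Real.exp (-τ / 2) := by
    refine (measureReal_biUnion_finset_le _ _).trans ?_
    rw [← nsmul_eq_mul]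
    refine Finset.sum_le_card_nsmul _ _ _ fun p hp => ?_
    exact sampleLaw_le_sampleCount_le Q (measurableSet_closedBall.diff hM) (hup p (hF₂ hp))
  calc _ ≤ (F₁.card + F₂.card) * Real.exp (-τ / 2) := by linarith
    _ ≤ _ := by gcongr

end Concentration

/-! ### The clutter model: regularity of its manifolds and mass of balls. -/

section Model

open Metric

variable {d D : ℕ} {κ : ℝ} {M 𝒦 : Set (Euc D)}

lemma isRegularManifold_of_mem_manifoldClass (hd : d ≤ D) (hκ : 0 < κ) (h𝒦 : IsCompact 𝒦)
    (hM : M ∈ manifoldClass d κ 𝒦) : IsRegularManifold d κ M := by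
  obtain ⟨hconn, hsmooth, hreach, hsub⟩ := hM
  have huniq : UniqueNearestWithin M κ := by
    intro x hx
    obtain ⟨r, hxr, hrκ⟩ := exists_between hx
    have h1 : ENNReal.ofReal r < reach M :=
      ((ENNReal.ofReal_lt_ofReal_iff hκ).2 hrκ).trans_le hreach
    obtain ⟨_, ⟨s, rfl, hs⟩, hrs⟩ := lt_sSup_iff.1 h1
    refine hs x ?_
    have h2 : r ≤ s := by
      rw [ENNReal.ofReal, ENNReal.coe_lt_coe] at hrs
      exact (Real.le_coe_toNNReal r).trans (NNReal.coe_le_coe.2 hrs.le)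
    obtain ⟨p, hp, hxp⟩ := (infDist_lt_iff hconn.nonempty).1 (hxr.trans_le h2)
    exact Set.mem_biUnion hp hxp
  -- A limit point of `M` is at distance 0, where a nearest point exists and must be the point
  -- itself.
  have hclosed : IsClosed M := by
    refine isClosed_of_closure_subset fun x hx => ?_
    have h0 : infDist x M = 0 := infDist_zero_of_mem_closure hx
    obtain ⟨p, ⟨hp, hxp⟩, -⟩ := huniq x (by rwa [h0])
    rw [h0, dist_eq_zero] at hxp
    rwa [hxp]
  exact ⟨h𝒦.of_isClosed_subset hclosed hsub, hconn, huniq,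
    fun p hp => hsmooth.isTangentSpaceAt hd hp, fun p hp => hsmooth.finrank_tangentSpaceAt hd hp⟩

/-- The distributions of the clutter model charge balls centred on the manifold with mass of order
at least `ρ ^ d`, and balls off the manifold with mass of order at most `ρ ^ D`. -/
lemma exists_clutterModel_bounds (hd : d ≤ D) (hκ : 0 < κ) (h𝒦 : IsCompact 𝒦)
    (hint : (interior 𝒦).Nonempty) {b π : ℝ} (B : ℝ) (hb : 0 < b) (hπ : 0 < π) (hπ1 : π ≤ 1) :
    ∃ c C : ℝ, 0 < c ∧ 0 < C ∧ ∀ p ∈ clutterModel d κ 𝒦 b B π, IsProbabilityMeasure p.2 ∧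
      (∀ y ∈ p.1, ∀ ρ, 0 < ρ → ρ ≤ κ / 32 → c * ρ ^ d ≤ p.2.real (p.1 ∩ closedBall y ρ)) ∧
      ∀ y ρ, 0 < ρ → p.2.real (closedBall y ρ \ p.1) ≤ C * ρ ^ D := by
  obtain ⟨c, hc, hG⟩ := IsRegularManifold.exists_le_measure_closedBall d hκ h𝒦 hb
  have hv0 : volume 𝒦 ≠ 0 := (MeasureTheory.Measure.measure_pos_of_nonempty_interior _ hint).ne'
  have hv1 : volume 𝒦 ≠ ⊤ := h𝒦.measure_lt_top.ne
  have hvr : 0 < volume.real 𝒦 := ENNReal.toReal_pos hv0 hv1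
  have hball : 0 < volume.real (ball (0 : Euc D) 1) :=
    ENNReal.toReal_pos (measure_ball_pos _ _ one_pos).ne' measure_ball_lt_top.ne
  have hU : IsProbabilityMeasure (ProbabilityTheory.cond volume 𝒦) :=
    ProbabilityTheory.cond_isProbabilityMeasure_of_finite hv0 hv1
  refine ⟨π * c, volume.real (ball (0 : Euc D) 1) / volume.real 𝒦, by positivity, by positivity, ?_⟩
  rintro ⟨M, Q⟩ ⟨hM, G, hGM, hQ⟩
  simp only at hM hGM hQ ⊢
  have hreg := isRegularManifold_of_mem_manifoldClass hd hκ h𝒦 hM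
  have hGprob : IsProbabilityMeasure G := hGM.1
  have hQprob : IsProbabilityMeasure Q := by
    refine ⟨?_⟩
    rw [hQ, Measure.add_apply, Measure.smul_apply, Measure.smul_apply, measure_univ, measure_univ,
      smul_eq_mul, smul_eq_mul, mul_one, mul_one, ← ENNReal.ofReal_add (by linarith) hπ.le]
    simp
  refine ⟨hQprob, fun y hy ρ hρ hρκ => ?_, fun y ρ hρ => ?_⟩
  · have h1 := hG M hreg hM.2.2.2 B G hGM y hy ρ hρ hρκ
    have h2 : ENNReal.ofReal (π * c * ρ ^ d) ≤ Q (M ∩ closedBall y ρ) := by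
      rw [hQ, Measure.add_apply, Measure.smul_apply, Measure.smul_apply, mul_assoc,
        ENNReal.ofReal_mul hπ.le, smul_eq_mul, smul_eq_mul]
      exact le_add_left (by gcongr)
    exact (ENNReal.ofReal_le_iff_le_toReal (measure_ne_top _ _)).1 h2
  · have hMm : MeasurableSet M := hreg.isCompact.isClosed.measurableSet
    -- Off `M` only the uniform component remains, with mass of order `ρ ^ D`.
    have hG0 : G (closedBall y ρ \ M) = 0 := by
      obtain ⟨-, g, -, -, rfl⟩ := hGM
      refine withDensity_absolutelyContinuous _ _ ?_
      rw [uniformOnManifold, ProbabilityTheory.cond_apply hMm]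
      simp
    have hU' : ProbabilityTheory.cond volume 𝒦 (closedBall y ρ \ M) ≤
        ENNReal.ofReal (volume.real (ball (0 : Euc D) 1) / volume.real 𝒦 * ρ ^ D) := by
      rw [ProbabilityTheory.cond_apply h𝒦.isClosed.measurableSet]
      calc (volume 𝒦)⁻¹ * volume (𝒦 ∩ (closedBall y ρ \ M))
          ≤ (volume 𝒦)⁻¹ * volume (closedBall y ρ) := by
            gcongr
            exact fun x hx => hx.2.1
        _ = (volume 𝒦)⁻¹ * (ENNReal.ofReal (ρ ^ D) * volume (ball (0 : Euc D) 1)) := by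
            rw [Measure.addHaar_closedBall _ _ hρ.le, finrank_euclideanSpace, Fintype.card_fin]
        _ = _ := by
            rw [← ofReal_measureReal (μ := volume) (s := 𝒦) hv1, ← ENNReal.ofReal_inv_of_pos hvr,
              ← ofReal_measureReal (μ := volume) (s := ball (0 : Euc D) 1) measure_ball_lt_top.ne,
              ← ENNReal.ofReal_mul (by positivity), ← ENNReal.ofReal_mul (by positivity)]
            congr 1
            ring
    have h2 : Q (closedBall y ρ \ M) ≤
        ENNReal.ofReal (volume.real (ball (0 : Euc D) 1) / volume.real 𝒦 * ρ ^ D) := by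
      rw [hQ, Measure.add_apply, Measure.smul_apply, Measure.smul_apply, hG0, smul_zero, add_zero,
        smul_eq_mul]
      refine le_trans ?_ hU'
      calc _ ≤ 1 * ProbabilityTheory.cond volume 𝒦 (closedBall y ρ \ M) := by
            gcongr
            rw [← ENNReal.ofReal_one]
            exact ENNReal.ofReal_le_ofReal (by linarith)
        _ = _ := one_mul _
    exact ENNReal.toReal_le_of_le_ofReal (by positivity) h2

end Model

/-! ### Existence of the estimator and its deterministic analysis. -/

section Estimator

open Metric

variable {d D n : ℕ} {κ : ℝ} {M M₀ 𝒦 : Set (Euc D)} {S : Set (Euc D) → Euc D → Set (Euc D)}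

lemma empiricalMass_nonneg (Y : Fin n → Euc D) (A : Set (Euc D)) : 0 ≤ empiricalMass Y A := by
  unfold empiricalMass; positivity

lemma minSlabMass_le (Y : Fin n → Euc D) {y : Euc D} (hy : y ∈ M) :
    minSlabMass S Y M ≤ empiricalMass Y (S M y) :=
  ciInf_le (f := fun y : M => empiricalMass Y (S M y))
    ⟨0, by rintro _ ⟨i, rfl⟩; exact empiricalMass_nonneg _ _⟩ ⟨y, hy⟩

lemma exists_orthonormalBasis_span_eq {T : Submodule ℝ (Euc D)} (hT : Module.finrank ℝ T = d)
    (hd : d ≤ D) : ∃ e : OrthonormalBasis (Fin D) ℝ (Euc D),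
      Submodule.span ℝ (e '' {i : Fin D | (i : ℕ) < d}) = T := by
  set b := (stdOrthonormalBasis ℝ T).reindex (finCongr hT)
  set v : Fin D → Euc D := fun i => if h : (i : ℕ) < d then b ⟨i, h⟩ else 0 with hv
  have hvi : ∀ (i : Fin D) (h : (i : ℕ) < d), v i = b ⟨i, h⟩ := fun i h => by simp [hv, h]
  have hon : Orthonormal ℝ (Set.domRestrict {i : Fin D | (i : ℕ) < d} v) := by
    have hb : Orthonormal ℝ (fun i : Fin d => (b i : Euc D)) :=
      b.orthonormal.comp_linearIsometry T.subtypeₗᵢ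
    have := hb.comp (fun i : {i : Fin D | (i : ℕ) < d} => (⟨i.1, i.2⟩ : Fin d))
      (fun i j hij => Subtype.ext (Fin.ext (by simpa using hij)))
    convert this using 1
    ext1 i
    exact hvi i.1 i.2
  obtain ⟨e, he⟩ := hon.exists_orthonormalBasis_extension_of_card_eq (by simp)
  refine ⟨e, ?_⟩
  have himg : e '' {i : Fin D | (i : ℕ) < d} = T.subtype '' Set.range b := by
    ext x
    constructor
    · rintro ⟨i, hi, rfl⟩
      exact ⟨_, ⟨⟨i, hi⟩, rfl⟩, by rw [he i hi, hvi i hi]; rfl⟩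
    · rintro ⟨_, ⟨i, rfl⟩, rfl⟩
      have hi : ((Fin.castLE hd i : Fin D) : ℕ) < d := i.2
      exact ⟨Fin.castLE hd i, hi, by rw [he _ hi, hvi _ hi]; rfl⟩
  have hspan : Submodule.span ℝ (Set.range b) = ⊤ := by
    rw [← b.coe_toBasis]; exact b.toBasis.span_eq
  rw [himg, Submodule.span_image, hspan, Submodule.map_top, Submodule.range_subtype]

lemma exists_isSlabChoice (hd : d ≤ D) (κ : ℝ) (𝒦 : Set (Euc D)) (ℓ₁ ℓ₂ : ℝ) :
    ∃ S, IsSlabChoice d κ 𝒦 ℓ₁ ℓ₂ S := by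
  have key : ∀ M y, ∃ S : Set (Euc D), M ∈ manifoldClass d κ 𝒦 → y ∈ M →
      IsSlab d ℓ₁ ℓ₂ M y S := by
    intro M y
    by_cases h : M ∈ manifoldClass d κ 𝒦 ∧ y ∈ M
    · obtain ⟨e, he⟩ := exists_orthonormalBasis_span_eq (h.1.2.1.finrank_tangentSpaceAt hd h.2) hd
      exact ⟨_, fun _ _ => ⟨e, he, rfl⟩⟩
    · exact ⟨∅, fun h1 h2 => absurd ⟨h1, h2⟩ h⟩
  choose S hS using key
  exact ⟨S, fun M hM y hy => hS M y hM hy⟩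

/-- Empirical masses are among the finitely many values `k / n`, so the infima are attained and `s`
takes finitely many values. -/
lemma exists_isArgmaxEstimator (hne : (manifoldClass d κ 𝒦).Nonempty)
    (S : Set (Euc D) → Euc D → Set (Euc D)) :
    ∃ Mhat : (Fin n → Euc D) → Set (Euc D), IsArgmaxEstimator d κ 𝒦 S Mhat := by
  have key : ∀ Y : Fin n → Euc D, ∃ M ∈ manifoldClass d κ 𝒦,
      IsMaxOn (minSlabMass S Y) (manifoldClass d κ 𝒦) M := by
    intro Y
    have hfin : (Set.range fun k : Fin (n + 1) => ((k : ℕ) : ℝ) / n).Finite := Set.finite_range _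
    have hsub : ∀ A, empiricalMass Y A ∈ Set.range fun k : Fin (n + 1) => ((k : ℕ) : ℝ) / n := by
      intro A
      have hle : Nat.card {i : Fin n // Y i ∈ A} ≤ n := by
        simpa using Nat.card_le_card_of_injective
          (fun i : {i : Fin n // Y i ∈ A} => (i : Fin n)) Subtype.val_injective
      exact ⟨⟨_, Nat.lt_succ_of_le hle⟩, rfl⟩
    have himg : (minSlabMass S Y '' manifoldClass d κ 𝒦).Finite := by
      refine hfin.subset ?_
      rintro _ ⟨M, hM, rfl⟩
      have : Nonempty M := hM.1.nonempty.to_subtype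
      obtain ⟨y, hy⟩ := Set.Nonempty.csInf_mem
        (Set.range_nonempty fun y : M => empiricalMass Y (S M y))
        (hfin.subset (by rintro _ ⟨y, rfl⟩; exact hsub _))
      rw [minSlabMass, iInf, ← hy]
      exact hsub _
    obtain ⟨_, ⟨M, hM, rfl⟩, hmax⟩ := Set.exists_max_image _ id himg (hne.image _)
    exact ⟨M, hM, fun M' hM' => hmax _ ⟨M', hM', rfl⟩⟩
  choose Mhat h1 h2 using key
  exact ⟨Mhat, fun Y => ⟨h1 Y, h2 Y⟩⟩

/-- On the event that balls centred on `M₀` contain more than `τ` observations and balls contain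
less than `τ` observations outside `M₀`, the estimator is `ε`-close to `M₀`. -/
lemma IsArgmaxEstimator.hausdorffDist_le (hd : d ≤ D) (hκ : 0 < κ) (h𝒦 : IsCompact 𝒦)
    {Mhat : (Fin n → Euc D) → Set (Euc D)} (hMhat : IsArgmaxEstimator d κ 𝒦 S Mhat)
    (hM₀ : M₀ ∈ manifoldClass d κ 𝒦) {ℓ₁ ℓ₂ L ε h₁ h₂ τ : ℝ}
    (hS : IsSlabChoice d κ 𝒦 ℓ₁ ℓ₂ S) (hε : 0 < ε) (hεκ : ε ≤ κ / 4096) (hℓ₁ : ℓ₁ ≤ L)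
    (hℓ₂ : 0 ≤ ℓ₂) (hℓ₂' : ℓ₂ ≤ L) (hL : (D * (L / 2)) ^ 2 ≤ κ * ε / 16)
    (hℓ₂ε : D * (ℓ₂ / 2) ≤ ε / 8)
    (hh₁ : 2 * h₁ ≤ ℓ₁ / 2) (hh₁' : (2 * h₁) ^ 2 ≤ κ * ℓ₂) (hh₂ : D * (L / 2) ≤ h₂)
    (hn : 0 < n) {Y : Fin n → Euc D}
    (hlow : ∀ y ∈ M₀, τ < sampleCount Y (M₀ ∩ closedBall y (2 * h₁)))
    (hup : ∀ y ∈ 𝒦, sampleCount Y (closedBall y h₂ \ M₀) < τ) :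
    hausdorffDist M₀ (Mhat Y) ≤ ε := by
  by_contra hlt
  rw [not_le] at hlt
  have hn' : (0 : ℝ) < n := by exact_mod_cast hn
  obtain ⟨hMc, hmax⟩ := hMhat Y
  have hreg := isRegularManifold_of_mem_manifoldClass hd hκ h𝒦 hMc
  have hreg₀ := isRegularManifold_of_mem_manifoldClass hd hκ h𝒦 hM₀
  have hb : ∀ y ∈ Mhat Y, ∀ z ∈ S (Mhat Y) y, ‖z - y‖ ≤ D * (L / 2) := fun y hy z hz =>
    (hS _ hMc y hy).norm_sub_le hℓ₁ hℓ₂' hz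
  obtain ⟨y, hy, hdisj⟩ := hreg.exists_disjoint_of_lt_hausdorffDist hreg₀ hκ hε hεκ hlt
    (S := S (Mhat Y))
    (fun y hy z hz => (pow_le_pow_left₀ (norm_nonneg _) (hb y hy z hz) 2).trans hL)
    (fun y hy z hz u hu => ((hS _ hMc y hy).abs_inner_le hℓ₂ hz hu).trans (by gcongr))
  -- The slab missing `M₀` lies in a ball of radius `h₂`, hence sees only clutter.
  have h1 : minSlabMass S Y (Mhat Y) < τ / n := by
    refine (minSlabMass_le Y hy).trans_lt ?_
    rw [empiricalMass_eq]
    gcongr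
    refine (sampleCount_mono Y fun i hi => ?_).trans_lt (hup y (hMc.2.2.2 hy))
    refine ⟨?_, Set.disjoint_left.1 hdisj hi⟩
    rw [mem_closedBall, dist_eq_norm]
    exact (hb y hy _ hi).trans hh₂
  -- Points of `M₀` within `2 * h₁` of `y` deviate from the tangent space by at most `(2 * h₁) ^ 2 /
  -- (2 * κ) ≤ ℓ₂ / 2`, so they stay in the slab.
  have h2 : τ / n ≤ minSlabMass S Y M₀ := by
    have : Nonempty M₀ := hM₀.1.nonempty.to_subtype
    refine le_ciInf fun y => ?_
    rw [empiricalMass_eq]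
    gcongr
    refine (hlow y y.2).le.trans (sampleCount_mono Y fun i hi => ?_)
    have hi2 := hi.2
    rw [mem_closedBall, dist_eq_norm] at hi2
    refine (hS _ hM₀ y y.2).mem_of_norm_le (hi2.trans hh₁) ?_
    have h3 := hreg₀.norm_sub_starProjection_le hκ y.2 hi.1
    have h4 : ‖Y i - y‖ ^ 2 ≤ (2 * h₁) ^ 2 := by gcongr
    refine le_of_mul_le_mul_left ?_ hκ
    linarith
  exact absurd (hmax hM₀) (not_le.2 (h1.trans_le h2))

end Estimator

/-! ### Choice of constants and the rate. -/

section Rates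

open Filter Metric
open scoped Topology

lemma resolution_nonneg {K : ℝ} (hK : 0 ≤ K) (d n : ℕ) : 0 ≤ resolution d K n := by
  unfold resolution
  have := Real.log_natCast_nonneg n
  positivity

lemma resolution_pos {K : ℝ} (hK : 0 < K) (d : ℕ) {n : ℕ} (hn : 2 ≤ n) :
    0 < resolution d K n := by
  have h : (1 : ℝ) < n := by exact_mod_cast hn
  have := Real.log_pos h
  unfold resolution
  positivity

lemma sqrt_resolution_pow {K : ℝ} (hK : 0 ≤ K) {d : ℕ} (hd : 1 ≤ d) (n : ℕ) :
    √(resolution d K n) ^ d = K * Real.log n / n := by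
  have hlog := Real.log_natCast_nonneg n
  have hx : 0 ≤ K * Real.log n / n := by positivity
  have hd' : (d : ℝ) ≠ 0 := by exact_mod_cast (by omega : d ≠ 0)
  rw [resolution, Real.sqrt_eq_rpow, ← Real.rpow_mul hx, ← Real.rpow_natCast, ← Real.rpow_mul hx]
  have : 2 / (d : ℝ) * (1 / 2) * d = 1 := by field_simp
  rw [this, Real.rpow_one]

lemma tendsto_sqrt_resolution (K : ℝ) {d : ℕ} (hd : 1 ≤ d) :
    Tendsto (fun n : ℕ => √(resolution d K n)) atTop (𝓝 0) := by
  have hd' : 0 < 2 / (d : ℝ) := by have : 0 < d := hd; positivity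
  have h1 : Tendsto (fun n : ℕ => K * (Real.log n / n)) atTop (𝓝 0) := by
    have := (Real.tendsto_pow_log_div_mul_add_atTop 1 0 1 one_ne_zero).comp
      (tendsto_natCast_atTop_atTop (R := ℝ))
    simpa [Function.comp_def] using this.const_mul K
  have h2 := (h1.rpow_const (p := 2 / (d : ℝ)) (Or.inr hd'.le))
  rw [Real.zero_rpow hd'.ne'] at h2
  have h3 := h2.sqrt
  rw [Real.sqrt_zero] at h3
  refine h3.congr fun n => ?_
  rw [resolution, mul_div_assoc]

variable {d D : ℕ} {κ : ℝ} {𝒦 : Set (Euc D)}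

/-- The largest slab constant for which the estimator is analysed. -/
noncomputable def maxSlabConstant (D : ℕ) (κ : ℝ) : ℝ := min 1 κ / (4 * D ^ 2)

lemma sq_mul_maxSlabConstant (hD : 1 ≤ D) (κ : ℝ) :
    (D : ℝ) ^ 2 * maxSlabConstant D κ = min 1 κ / 4 := by
  have : (0 : ℝ) < D := by exact_mod_cast hD
  rw [maxSlabConstant]
  field_simp

lemma mul_maxSlabConstant_le (hD : 1 ≤ D) (κ : ℝ) : D * maxSlabConstant D κ ≤ 1 / 4 := by
  have h1 : (1 : ℝ) ≤ D := by exact_mod_cast hD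
  have h2 := sq_mul_maxSlabConstant hD κ
  have h3 := min_le_left 1 κ
  rcases le_total 0 (maxSlabConstant D κ) with h | h
  · nlinarith
  · nlinarith

lemma sq_mul_maxSlabConstant_le (hD : 1 ≤ D) (hκ : 0 ≤ κ) :
    (D * maxSlabConstant D κ) ^ 2 ≤ κ / 16 := by
  have h1 : (1 : ℝ) ≤ D := by exact_mod_cast hD
  have h0 : 0 ≤ maxSlabConstant D κ := by unfold maxSlabConstant; positivity
  have h2 := sq_mul_maxSlabConstant hD κ
  have h3 := min_le_right 1 κ
  have h4 := mul_maxSlabConstant_le hD κ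
  calc (D * maxSlabConstant D κ) ^ 2 = D ^ 2 * maxSlabConstant D κ * maxSlabConstant D κ := by ring
    _ ≤ κ / 4 * (1 / 4) := by gcongr <;> nlinarith
    _ = κ / 16 := by ring

set_option maxHeartbeats 1000000 in
/-- The estimator misses the manifold by more than the resolution with probability smaller than
any prescribed power of the sample size. -/
lemma exists_sampleLaw_hausdorffDist_le (hd : 1 ≤ d) (hdD : d < D) (hκ : 0 < κ) {b₁ b₂ : ℝ}
    (hb₁ : 0 < b₁) (hb₁' : b₁ ≤ maxSlabConstant D κ) (hb₂ : 0 < b₂)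
    (hb₂' : b₂ ≤ maxSlabConstant D κ) (h𝒦 : IsCompact 𝒦) (hint : (interior 𝒦).Nonempty)
    {b B π ξ : ℝ} (hb : 0 < b) (hπ : 0 < π) (hπ1 : π ≤ 1) :
    ∃ K₀ : ℝ, 1 ≤ K₀ ∧ ∀ K : ℝ, K₀ ≤ K → ∃ n₀ : ℕ, ∀ n : ℕ, n₀ ≤ n →
      (n : ℝ) ^ (-2 : ℝ) ≤ resolution d K n ∧
      ∀ S, IsSlabChoice d κ 𝒦 (b₁ * √(resolution d K n)) (b₂ * resolution d K n) S →
      ∀ Mhat : (Fin n → Euc D) → Set (Euc D), IsArgmaxEstimator d κ 𝒦 S Mhat →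
      ∀ p ∈ clutterModel d κ 𝒦 b B π,
        sampleLaw p.2 n {Y | resolution d K n < hausdorffDist p.1 (Mhat Y)} ≤
          ENNReal.ofReal ((n : ℝ) ^ (-ξ)) := by
  obtain ⟨c, C, hc, hC, hmodel⟩ := exists_clutterModel_bounds hdD.le hκ h𝒦 hint B hb hπ hπ1
  obtain ⟨C', hC', hnet⟩ := exists_net h𝒦.isBounded
  have hDpos : (1 : ℝ) ≤ D := by exact_mod_cast (by omega : 1 ≤ D)
  set b₀ := maxSlabConstant D κ
  have hb₀pos : 0 < b₀ := hb₁.trans_le hb₁'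
  have hDb₀1 : D * b₀ ≤ 1 / 4 := mul_maxSlabConstant_le (by omega) κ
  have hDb₀2 : (D * b₀) ^ 2 ≤ κ / 16 := sq_mul_maxSlabConstant_le (by omega) hκ.le
  clear_value b₀
  -- The ball of radius `2 a₁ √ε` must fit the long half-side (`b₁ / 4`), and the curvature of `M₀`
  -- the short one (`κ b₂ / 4`, with `a₁ ≤ 1`).
  set a₁ := min (b₁ / 4) (min 1 (κ * b₂ / 4)) with ha₁
  have ha₁0 : 0 < a₁ := by positivity
  have ha₁b : a₁ ≤ b₁ / 4 := min_le_left _ _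
  have ha₁1 : a₁ ≤ 1 := (min_le_right _ _).trans (min_le_left _ _)
  have ha₁κ : a₁ ≤ κ * b₂ / 4 := (min_le_right _ _).trans (min_le_right _ _)
  clear_value a₁
  set a₂ := D * (b₀ / 2) with ha₂
  have ha₂0 : 0 < a₂ := by positivity
  have ha₂1 : a₂ ≤ 1 := by rw [ha₂]; linarith
  -- Chosen so that `4 τ` with `τ = c₁ K log n` equals the guaranteed expected count in balls of
  -- radius `a₁ √ε` about points of `M₀`.
  set c₁ := c * a₁ ^ d / 4 with hc₁
  have hc₁0 : 0 < c₁ := by positivity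
  set C₃ := C * (2 * a₂) ^ D with hC₃
  have hC₃0 : 0 < C₃ := by positivity
  set C₄ := C' / a₁ ^ D + C' / a₂ ^ D with hC₄
  have hC₄0 : 0 < C₄ := by positivity
  -- The factor `n ^ (-c₁ K / 2)` pays for the net (`D`), for its constant `C₄ ≤ n` (`1`), and
  -- leaves `ξ`.
  refine ⟨max 1 (2 * (D + ξ + 1) / c₁), le_max_left _ _, fun K hK => ?_⟩
  have hK1 : 1 ≤ K := (le_max_left _ _).trans hK
  have hK2 : D + ξ + 1 ≤ c₁ * K / 2 := by
    have := (le_max_right _ _).trans hK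
    rw [div_le_iff₀ hc₁0] at this
    linarith
  set σ := min 1 (min (κ / 4096) (c₁ / (4 * C₃))) with hσ
  have hσ0 : 0 < σ := by positivity
  have hev : ∀ᶠ n : ℕ in atTop, √(resolution d K n) < σ :=
    (tendsto_sqrt_resolution K hd).eventually_lt_const hσ0
  obtain ⟨n₁, hn₁⟩ := eventually_atTop.1 hev
  obtain ⟨n₂, hn₂⟩ := exists_nat_ge C₄
  refine ⟨max (max n₁ n₂) 3, fun n hn => ?_⟩
  have hnn₁ : n₁ ≤ n := by omega
  have hnn₂ : C₄ ≤ n := hn₂.trans (by exact_mod_cast (by omega : n₂ ≤ n))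
  have hn3 : 3 ≤ n := by omega
  have hn0 : 0 < n := by omega
  have hnR : (0 : ℝ) < n := by exact_mod_cast hn0
  have hlog1 : 1 ≤ Real.log n := by
    rw [Real.le_log_iff_exp_le hnR]
    have : (3 : ℝ) ≤ n := by exact_mod_cast hn3
    linarith [Real.exp_one_lt_d9]
  set ε := resolution d K n with hε
  have hε0 : 0 < ε := resolution_pos (by linarith) d (by omega)
  set s := √ε with hs
  have hs0 : 0 < s := Real.sqrt_pos.2 hε0
  have hsε : s ^ 2 = ε := Real.sq_sqrt hε0.le
  have hsσ : s < σ := hn₁ n hnn₁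
  have hs1 : s ≤ 1 := hsσ.le.trans (min_le_left _ _)
  have hsκ : s ≤ κ / 4096 := hsσ.le.trans ((min_le_right _ _).trans (min_le_left _ _))
  have hsC : s * C₃ ≤ c₁ / 4 := by
    have := hsσ.le.trans ((min_le_right _ _).trans (min_le_right _ _))
    rw [le_div_iff₀ (by positivity)] at this
    linarith
  have hsd : n * s ^ d = K * Real.log n := by
    rw [hs, hε, sqrt_resolution_pow (by linarith) hd, mul_div_cancel₀ _ hnR.ne']
  have hεs : ε ≤ s := by rw [← hsε]; nlinarith
  -- This bounds net sizes of order `s ^ (-D)` by order `n ^ D`, and also gives `ε ≥ n ^ (-2)`.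
  have hns : 1 / (n : ℝ) ≤ s := by
    have h1 : s ^ d ≤ s := pow_le_of_le_one hs0.le hs1 (by omega)
    rw [div_le_iff₀ hnR]
    calc 1 ≤ K * Real.log n := one_le_mul_of_one_le_of_one_le hK1 hlog1
      _ = n * s ^ d := hsd.symm
      _ ≤ n * s := by gcongr
      _ = s * n := mul_comm _ _
  clear_value s ε
  have hres : (n : ℝ) ^ (-2 : ℝ) ≤ ε := by
    rw [← hsε, Real.rpow_neg hnR.le, Real.rpow_two, ← inv_pow, ← one_div]
    gcongr
  refine ⟨hres, ?_⟩
  rintro S hS Mhat hMhat ⟨M₀, Q⟩ hp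
  obtain ⟨hQ, hlowQ, hupQ⟩ := hmodel _ hp
  simp only at hQ hlowQ hupQ ⊢
  have hM₀ : M₀ ∈ manifoldClass d κ 𝒦 := hp.1
  have hM₀m : MeasurableSet M₀ :=
    (isRegularManifold_of_mem_manifoldClass hdD.le hκ h𝒦 hM₀).isCompact.isClosed.measurableSet
  have hprob : IsProbabilityMeasure (sampleLaw Q n) := by unfold sampleLaw; infer_instance
  set τ := c₁ * (K * Real.log n) with hτ
  have hτ0 : 0 ≤ τ := by positivity
  obtain ⟨F₁, hF₁, hF₁c, hF₁n⟩ := hnet (a₁ * s) (by positivity)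
    (mul_le_one₀ ha₁1 hs0.le hs1) M₀ hM₀.2.2.2
  obtain ⟨F₂, hF₂, hF₂c, hF₂n⟩ := hnet (a₂ * s) (by positivity)
    (mul_le_one₀ ha₂1 hs0.le hs1) 𝒦 subset_rfl
  have hlow : ∀ y ∈ M₀, 4 * τ ≤ n * Q.real (M₀ ∩ closedBall y (a₁ * s)) := by
    intro y hy
    have h1 := hlowQ y hy (a₁ * s) (by positivity)
      ((mul_le_of_le_one_left hs0.le ha₁1).trans (by linarith))
    calc 4 * τ = n * (c * (a₁ * s) ^ d) := by
          rw [hτ, ← hsd, hc₁, mul_pow]; ring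
      _ ≤ _ := by gcongr
  have hup : ∀ y ∈ 𝒦, n * Q.real (closedBall y (2 * (a₂ * s)) \ M₀) ≤ τ / 4 := by
    intro y _
    have h1 := hupQ y (2 * (a₂ * s)) (by positivity)
    -- Positive codimension provides the spare factor `s` that makes clutter negligible.
    have h2 : s ^ D ≤ s ^ d * s := by
      rw [← pow_succ]; exact pow_le_pow_of_le_one hs0.le hs1 hdD
    calc n * Q.real (closedBall y (2 * (a₂ * s)) \ M₀) ≤ n * (C * (2 * (a₂ * s)) ^ D) := by gcongr
      _ = n * C₃ * s ^ D := by rw [hC₃, ← mul_assoc 2, mul_pow (2 * a₂)]; ring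
      _ ≤ n * C₃ * (s ^ d * s) := by gcongr
      _ = (n * s ^ d) * (s * C₃) := by ring
      _ ≤ (n * s ^ d) * (c₁ / 4) := by gcongr
      _ = τ / 4 := by rw [hsd, hτ]; ring
  have hcard : (F₁.card : ℝ) + F₂.card ≤ C₄ * (n : ℝ) ^ D := by
    have h1 : C₄ / s ^ D ≤ C₄ * (n : ℝ) ^ D := by
      rw [div_le_iff₀ (by positivity), mul_assoc, ← mul_pow]
      have : 1 ≤ (n : ℝ) * s := by rwa [div_le_iff₀' hnR] at hns
      exact le_mul_of_one_le_right hC₄0.le (one_le_pow₀ this)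
    refine le_trans (add_le_add hF₁c hF₂c) (le_trans (le_of_eq ?_) h1)
    rw [hC₄, mul_pow, mul_pow]
    field_simp
  have hdev := sampleLaw_uniform_deviation Q hM₀m hτ0 hlow hup hF₁ hF₂ hF₁n hF₂n hcard
  have hexp : C₄ * (n : ℝ) ^ D * Real.exp (-τ / 2) ≤ (n : ℝ) ^ (-ξ) := by
    have h1 : Real.exp (-τ / 2) = (n : ℝ) ^ (-(c₁ * K / 2)) := by
      rw [Real.rpow_def_of_pos hnR, hτ]; congr 1; ring
    have hn1 : (1 : ℝ) ≤ n := by exact_mod_cast hn0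
    calc C₄ * (n : ℝ) ^ D * Real.exp (-τ / 2)
        ≤ (n : ℝ) ^ (1 : ℝ) * (n : ℝ) ^ (D : ℝ) * (n : ℝ) ^ (-(D + ξ + 1)) := by
          rw [h1, Real.rpow_one, Real.rpow_natCast]
          gcongr
      _ = (n : ℝ) ^ (-ξ) := by
          rw [← Real.rpow_add hnR, ← Real.rpow_add hnR]; congr 1; ring
  have hsub : {Y | ε < hausdorffDist M₀ (Mhat Y)} ⊆ {Y |
      ¬ ((∀ y ∈ M₀, τ < sampleCount Y (M₀ ∩ closedBall y (2 * (a₁ * s)))) ∧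
      ∀ y ∈ 𝒦, sampleCount Y (closedBall y (a₂ * s) \ M₀) < τ)} := by
    intro Y hY hgood
    have hY' : ε < hausdorffDist M₀ (Mhat Y) := hY
    refine absurd hY' (not_lt.2 ?_)
    refine hMhat.hausdorffDist_le hdD.le hκ h𝒦 hM₀ (L := b₀ * s) (h₁ := a₁ * s) (h₂ := a₂ * s)
      (τ := τ) hS hε0 (hεs.trans hsκ) (by gcongr) (by positivity) ?_ ?_ ?_ ?_ ?_ ?_ hn0
      hgood.1 hgood.2
    · exact mul_le_mul hb₂' hεs hε0.le hb₀pos.le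
    · calc (D * (b₀ * s / 2)) ^ 2 = (D * b₀) ^ 2 * s ^ 2 / 4 := by ring
        _ ≤ κ / 16 * s ^ 2 / 4 := by gcongr
        _ ≤ κ * ε / 16 := by rw [hsε]; linarith [mul_pos hκ hε0]
    · calc D * (b₂ * ε / 2) ≤ D * (b₀ * ε / 2) := by gcongr
        _ = (D * b₀) * (ε / 2) := by ring
        _ ≤ 1 / 4 * (ε / 2) := by gcongr
        _ = ε / 8 := by ring
    · linarith [mul_le_mul_of_nonneg_right ha₁b hs0.le]
    · calc (2 * (a₁ * s)) ^ 2 = 4 * (a₁ * a₁) * s ^ 2 := by ring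
        _ ≤ 4 * (a₁ * 1) * s ^ 2 := by gcongr
        _ ≤ 4 * (κ * b₂ / 4 * 1) * s ^ 2 := by gcongr
        _ = κ * (b₂ * ε) := by rw [hsε]; ring
    · rw [ha₂]; exact le_of_eq (by ring)
  refine (measure_mono hsub).trans ?_
  rw [← ENNReal.ofReal_toReal (measure_ne_top (sampleLaw Q n) _)]
  exact ENNReal.ofReal_le_ofReal (hdev.trans hexp)

lemma hausdorffDist_le_diam_of_mem_manifoldClass {M M' : Set (Euc D)} (h𝒦 : IsCompact 𝒦)
    (hM : M ∈ manifoldClass d κ 𝒦) (hM' : M' ∈ manifoldClass d κ 𝒦) :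
    hausdorffDist M M' ≤ diam 𝒦 := by
  obtain ⟨x, hx⟩ := hM.1.nonempty
  obtain ⟨y, hy⟩ := hM'.1.nonempty
  refine hausdorffDist_le_of_mem_dist diam_nonneg (fun z hz => ⟨y, hy, ?_⟩)
    fun z hz => ⟨x, hx, ?_⟩
  · exact dist_le_diam_of_mem h𝒦.isBounded (hM.2.2.2 hz) (hM'.2.2.2 hy)
  · exact dist_le_diam_of_mem h𝒦.isBounded (hM'.2.2.2 hz) (hM.2.2.2 hx)

lemma outerExpectation_ofReal_le_const {Ω : Type*} [MeasurableSpace Ω] (P : Measure Ω)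
    [IsProbabilityMeasure P] {f : Ω → ℝ} {R : ℝ} (hR : ∀ x, f x ≤ R) :
    outerExpectation P (fun x => ENNReal.ofReal (f x)) ≤ ENNReal.ofReal R := by
  refine (iInf₂_le (fun _ => ENNReal.ofReal R) measurable_const).trans
    ((iInf_le _ fun x => ENNReal.ofReal_le_ofReal (hR x)).trans ?_)
  simp

lemma outerExpectation_ofReal_le {Ω : Type*} [MeasurableSpace Ω] (P : Measure Ω)
    [IsProbabilityMeasure P] {f : Ω → ℝ} {R ε δ : ℝ} (hR0 : 0 ≤ R) (hε : 0 ≤ ε) (hδ : 0 ≤ δ)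
    (hR : ∀ x, f x ≤ R) (hP : P {x | ε < f x} ≤ ENNReal.ofReal δ) :
    outerExpectation P (fun x => ENNReal.ofReal (f x)) ≤ ENNReal.ofReal (ε + R * δ) := by
  -- A measurable hull of the same measure supplies a measurable majorant of `f`.
  set A := toMeasurable P {x | ε < f x} with hA
  have hAm : MeasurableSet A := measurableSet_toMeasurable _ _
  refine (iInf₂_le (fun x => ENNReal.ofReal ε + A.indicator (fun _ => ENNReal.ofReal R) x)
    ((measurable_const.indicator hAm).const_add _)).trans ((iInf_le _ fun x => ?_).trans ?_)
  · dsimp only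
    by_cases hx : x ∈ A
    · rw [Set.indicator_of_mem hx]
      exact le_add_left (ENNReal.ofReal_le_ofReal (hR x))
    · rw [Set.indicator_of_notMem hx, add_zero]
      refine ENNReal.ofReal_le_ofReal (not_lt.1 fun h => hx (subset_toMeasurable _ _ h))
  · rw [lintegral_add_left measurable_const, lintegral_const, measure_univ, mul_one,
      lintegral_indicator_const hAm, hA, measure_toMeasurable, ENNReal.ofReal_add hε (by positivity),
      ENNReal.ofReal_mul hR0]
    gcongr

end Rates

/-! ### The probability bound and the risk bound. -/

theorem theorem4 (d D : ℕ) (hd : 1 ≤ d) (hdD : d < D) (κ : ℝ) (hκ : 0 < κ) :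
    ∃ b₀ : ℝ, 0 < b₀ ∧
    ∀ b₁ b₂ : ℝ, 0 < b₁ → b₁ ≤ b₀ → 0 < b₂ → b₂ ≤ b₀ →
    ∀ 𝒦 : Set (Euc D), IsCompact 𝒦 → (interior 𝒦).Nonempty →
    ∀ b B π ξ : ℝ, 0 < b → b ≤ B → 0 < π → π ≤ 1 → 1 < ξ →
    ∃ K₀ : ℝ, 0 < K₀ ∧ ∀ K : ℝ, K₀ ≤ K →
      -- the slabs and the estimator exist
      (∀ n : ℕ, 1 ≤ n → (manifoldClass d κ 𝒦).Nonempty →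
        (∃ S, IsSlabChoice d κ 𝒦
          (b₁ * √(resolution d K n)) (b₂ * resolution d K n) S) ∧
        ∀ S, IsSlabChoice d κ 𝒦
            (b₁ * √(resolution d K n)) (b₂ * resolution d K n) S →
          ∃ Mhat : (Fin n → Euc D) → Set (Euc D), IsArgmaxEstimator d κ 𝒦 S Mhat) ∧
      -- the probability bound
      (∃ n₀ : ℕ, ∀ n : ℕ, n₀ ≤ n →
        ∀ S, IsSlabChoice d κ 𝒦
            (b₁ * √(resolution d K n)) (b₂ * resolution d K n) S →
        ∀ Mhat : (Fin n → Euc D) → Set (Euc D), IsArgmaxEstimator d κ 𝒦 S Mhat →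
          ⨆ p ∈ clutterModel d κ 𝒦 b B π,
              sampleLaw p.2 n {Y | resolution d K n < Metric.hausdorffDist p.1 (Mhat Y)}
            < ENNReal.ofReal ((n : ℝ) ^ (-ξ))) ∧
      -- the bound on the expected loss
      (∃ C : ℝ, 0 < C ∧ ∀ n : ℕ, 2 ≤ n →
        ∀ S, IsSlabChoice d κ 𝒦
            (b₁ * √(resolution d K n)) (b₂ * resolution d K n) S →
        ∀ Mhat : (Fin n → Euc D) → Set (Euc D), IsArgmaxEstimator d κ 𝒦 S Mhat →
          ⨆ p ∈ clutterModel d κ 𝒦 b B π,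
              outerExpectation (sampleLaw p.2 n)
                (fun Y => ENNReal.ofReal (Metric.hausdorffDist p.1 (Mhat Y)))
            ≤ ENNReal.ofReal (C * resolution d K n)) := by
  have hD : (0 : ℝ) < D := by exact_mod_cast (by omega : 0 < D)
  refine ⟨maxSlabConstant D κ, by unfold maxSlabConstant; positivity, ?_⟩
  intro b₁ b₂ hb₁ hb₁' hb₂ hb₂' 𝒦 h𝒦 hint b B π ξ hb hbB hπ hπ1 hξ
  -- An exponent above `ξ` makes the final inequality strict, and one above `2` makes the failure
  -- probability at most `ε`, as `n ^ (-2) ≤ ε`.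
  obtain ⟨K₀, hK₀, H⟩ := exists_sampleLaw_hausdorffDist_le hd hdD hκ hb₁ hb₁' hb₂ hb₂' h𝒦 hint
    (B := B) hb hπ hπ1 (ξ := max ξ 2 + 1)
  refine ⟨K₀, by linarith, fun K hK => ?_⟩
  have hKpos : 0 < K := by linarith
  obtain ⟨n₀, hn₀⟩ := H K hK
  have hprob : ∀ p ∈ clutterModel d κ 𝒦 b B π, ∀ n, IsProbabilityMeasure (sampleLaw p.2 n) := by
    obtain ⟨_, _, _, _, hmodel⟩ := exists_clutterModel_bounds hdD.le hκ h𝒦 hint B hb hπ hπ1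
    intro p hp n
    have := (hmodel p hp).1
    unfold sampleLaw
    infer_instance
  refine ⟨fun n _ hne => ⟨exists_isSlabChoice hdD.le κ 𝒦 _ _, fun S _ =>
    exists_isArgmaxEstimator hne S⟩, ⟨max n₀ 2, fun n hn S hS Mhat hMhat => ?_⟩, ?_⟩
  · have hn1 : (1 : ℝ) < n := by exact_mod_cast (by omega : 1 < n)
    refine (iSup₂_le fun p hp => (hn₀ n (by omega)).2 S hS Mhat hMhat p hp).trans_lt ?_
    rw [ENNReal.ofReal_lt_ofReal_iff (Real.rpow_pos_of_pos (by linarith) _)]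
    refine Real.rpow_lt_rpow_of_exponent_lt hn1 ?_
    linarith [le_max_left ξ 2]
  · set R := Metric.diam 𝒦
    have hR0 : 0 ≤ R := Metric.diam_nonneg
    have hterm : ∀ n, 0 ≤ R / resolution d K n := fun n =>
      div_nonneg hR0 (resolution_nonneg hKpos.le d n)
    have hsum : 0 ≤ ∑ n ∈ Finset.range n₀, R / resolution d K n :=
      Finset.sum_nonneg fun n _ => hterm n
    -- For `n ≥ n₀` the risk is at most `ε + R ε`; the sum absorbs the finitely many smaller `n`,
    -- where the loss is only bounded by the diameter `R`.
    refine ⟨1 + R + ∑ n ∈ Finset.range n₀, R / resolution d K n, by linarith,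
      fun n hn S hS Mhat hMhat => iSup₂_le fun p hp => ?_⟩
    have hε : 0 < resolution d K n := resolution_pos hKpos d hn
    have hPn := hprob p hp n
    have hle : ∀ Y, Metric.hausdorffDist p.1 (Mhat Y) ≤ R := fun Y =>
      hausdorffDist_le_diam_of_mem_manifoldClass h𝒦 hp.1 (hMhat Y).1
    rcases lt_or_ge n n₀ with hlt | hge
    · refine (outerExpectation_ofReal_le_const _ hle).trans (ENNReal.ofReal_le_ofReal ?_)
      have h1 : R / resolution d K n ≤ ∑ n ∈ Finset.range n₀, R / resolution d K n :=
        Finset.single_le_sum (f := fun n => R / resolution d K n) (fun n _ => hterm n)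
          (Finset.mem_range.2 hlt)
      rw [← div_le_iff₀ hε]
      linarith
    · obtain ⟨hres, hP⟩ := hn₀ n hge
      refine (outerExpectation_ofReal_le _ hR0 hε.le (by positivity) hle
        (hP S hS Mhat hMhat p hp)).trans (ENNReal.ofReal_le_ofReal ?_)
      have h1 : (n : ℝ) ^ (-(max ξ 2 + 1)) ≤ resolution d K n := by
        refine le_trans (Real.rpow_le_rpow_of_exponent_le ?_ ?_) hres
        · exact_mod_cast (by omega : 1 ≤ n)
        · linarith [le_max_right ξ 2]
      nlinarith
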